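/- All graphs are finite and simple. For a graph $G=(V,E)$ without isolated vertices, let $\mathbf{L}$ be its normalized Laplacian, $(\mathbf{L}f)(v)=f(v)-\frac{1}{\deg v}\sum_{w\sim v}f(w)$ for $f:V\to\mathbb{R}$, let $\sigma(\mathbf{L})$ be its spectrum, and let $\mathrm{gap}(G)=\min_{\lambda\in\sigma(\mathbf{L})}|\lambda-1|$. For $d\ge 1$ let $\mathcal{G}_{\ge d}$ be the family of connected graphs on at least $3$ vertices with minimum degree $\ge d$, and $\mathcal{G}_{=d}$ the family of connected $d$-regular graphs on at least $3$ vertices. For a family $\mathcal{G}'$ of such graphs put $\mathbf{gap}(\mathcal{G}')=\sup_{G\in\mathcal{G}'}\mathrm{gap}(G)$ and $\mathbf{Extreme}(\mathcal{G}')=\{G\in\mathcal{G}':\mathrm{gap}(G)=\mathbf{gap}(\mathcal{G}')\}$. The incidence graph of a finite projective plane is the bipartite graph whose two parts are the points and the lines, a point $p$ and a line $l$ being adjacent if and only if $p\in l$; a plane has order $n$ if its lines have exactly $n+1$ points. Graphs are considered up to isomorphism. **Theorem.** Let $d\ge 3$. (1) If there exists a finite projective plane of order $d-1$, then $$\mathbf{gap}(\mathcal{G}_{=d})=\mathbf{gap}(\mathcal{G}_{\ge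 d})=\frac{\sqrt{d-1}}{d},$$ and $\mathbf{Extreme}(\mathcal{G}_{\ge d})=\mathbf{Extreme}(\mathcal{G}_{=d})$ is the set of incidence graphs of finite projective planes of order $d-1$. (2) Every $G\in\mathcal{G}_{=d}$ that is not the incidence graph of a finite projective plane of order $d-1$ satisfies $\mathrm{gap}(G)\le\frac{\sqrt{d-2}}{d}$. (3) If there is no finite projective plane of order $d-1$, then $\mathrm{gap}(G)<\frac{\sqrt{d-1}}{d}$ for every $G\in\mathcal{G}_{\ge d}$, and $\mathbf{gap}(\mathcal{G}_{=d})\le\frac{\sqrt{d-2}}{d}$. -/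

import Mathlib

universe u

noncomputable section

/-- The normalized Laplacian `𝐋 = 𝐈 - 𝐃⁻¹𝐀` of a finite simple graph, as an operator on
real functions on the vertices:
`(𝐋 f)(v) = f(v) - (1 / deg v) ∑_{w ∼ v} f(w)`. -/
def normalizedLaplacian {V : Type u} [Fintype V] (G : SimpleGraph V) [DecidableRel G.Adj] :
    Module.End ℝ (V → ℝ) where
  toFun f v := f v - (1 / (G.degree v : ℝ)) * ∑ w ∈ G.neighborFinset v, f w
  map_add' f g := by
    funext v
    simp only [Pi.add_apply, Finset.sum_add_distrib]
    ring
  map_smul' c f := by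
    funext v
    simp only [Pi.smul_apply, smul_eq_mul, RingHom.id_apply, ← Finset.mul_sum]
    ring

/-- A finite simple graph together with its vertex type. -/
structure FiniteGraph : Type (u + 1) where
  /-- the vertices -/
  V : Type u
  /-- there are finitely many vertices -/
  fin : Fintype V
  /-- the adjacency structure -/
  graph : SimpleGraph V

attribute [instance] FiniteGraph.fin

namespace FiniteGraph

open scoped Classical in
/-- The spectrum of the normalized Laplacian.  (The normalized Laplacian is similar to a real
symmetric matrix, so that all of its eigenvalues are real.) -/
def laplacianSpectrum (G : FiniteGraph.{u}) : Set ℝ :=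
  spectrum ℝ (normalizedLaplacian G.graph)

/-- The spectral gap from `1`: `gap(G) = min_{λ ∈ σ(𝐋)} |λ - 1|`.  See `isLeast_gap`. -/
def gap (G : FiniteGraph.{u}) : ℝ :=
  sInf ((fun x : ℝ => |x - 1|) '' G.laplacianSpectrum)

open scoped Classical in
/-- Connected graphs on at least three vertices, all of whose degrees are at least `d`. -/
def minDegreeGE (d : ℕ) : Set FiniteGraph.{u} :=
  {G | G.graph.Connected ∧ 3 ≤ Fintype.card G.V ∧ ∀ v, d ≤ G.graph.degree v}

open scoped Classical in
/-- Connected `d`-regular graphs on at least three vertices. -/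
def regular (d : ℕ) : Set FiniteGraph.{u} :=
  {G | G.graph.Connected ∧ 3 ≤ Fintype.card G.V ∧ ∀ v, G.graph.degree v = d}

/-- The spectral gap from `1` of a family of graphs: the supremum of `gap` over the family.
See `isLUB_familyGap`. -/
def familyGap (F : Set FiniteGraph.{u}) : ℝ :=
  sSup (gap '' F)

/-- The extremal graphs of a family: those that attain the supremum of the gap. -/
def extremal (F : Set FiniteGraph.{u}) : Set FiniteGraph.{u} :=
  {G | G ∈ F ∧ G.gap = familyGap F}

end FiniteGraph

/-- The incidence graph of points `P` and lines `L`: the bipartite graph on `P ⊔ L` in which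
`p` and `l` are adjacent if and only if `p ∈ l`. -/
def incidenceGraph (P L : Type u) [Membership P L] : SimpleGraph (P ⊕ L) where
  Adj
    | Sum.inl p, Sum.inr l => p ∈ l
    | Sum.inr l, Sum.inl p => p ∈ l
    | _, _ => False
  symm := ⟨by rintro (a | a) (b | b) h <;> exact h⟩
  loopless := ⟨by rintro (a | a) h <;> exact h⟩

/-- There is a finite projective plane of order `n`. -/
def ExistsProjectivePlane (n : ℕ) : Prop :=
  ∃ (P L : Type u) (_ : Finite P) (_ : Finite L) (_ : Membership P L)
    (_ : Configuration.ProjectivePlane P L), Configuration.ProjectivePlane.order P L = n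

/-- The incidence graphs (up to isomorphism) of finite projective planes of order `n`. -/
def planeIncidenceGraphs (n : ℕ) : Set FiniteGraph.{u} :=
  {G | ∃ (P L : Type u) (_ : Finite P) (_ : Finite L) (_ : Membership P L)
    (_ : Configuration.ProjectivePlane P L), Configuration.ProjectivePlane.order P L = n ∧
      Nonempty (G.graph ≃g incidenceGraph P L)}

namespace FiniteGraph

/-- Without isolated vertices, `0` is an eigenvalue of the normalized Laplacian. -/
theorem zero_mem_laplacianSpectrum {d : ℕ} (hd : 0 < d) {G : FiniteGraph.{u}}
    (hG : G ∈ minDegreeGE d) : (0 : ℝ) ∈ G.laplacianSpectrum := by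
  classical
  obtain ⟨hc, -, hdeg⟩ := hG
  have := hc.nonempty
  rw [laplacianSpectrum, ← Module.End.hasEigenvalue_iff_mem_spectrum]
  refine Module.End.hasEigenvalue_of_hasEigenvector (x := fun _ => (1 : ℝ)) ⟨?_, ?_⟩
  · rw [Module.End.mem_eigenspace_iff]
    funext v
    have hv : (G.graph.degree v : ℝ) ≠ 0 := by
      have := hdeg v
      exact_mod_cast (by convert (by omega : G.graph.degree v ≠ 0))
    simp [normalizedLaplacian]
    rw [inv_mul_cancel₀ (by convert hv), sub_self]
  · intro h
    obtain ⟨v⟩ := this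
    simpa using congrFun h v

/-- The minimum that defines the gap is attained. -/
theorem isLeast_gap {d : ℕ} (hd : 0 < d) {G : FiniteGraph.{u}} (hG : G ∈ minDegreeGE d) :
    IsLeast ((fun x : ℝ => |x - 1|) '' G.laplacianSpectrum) G.gap := by
  have hfin : ((fun x : ℝ => |x - 1|) '' G.laplacianSpectrum).Finite :=
    (Module.End.finite_spectrum _).image _
  have hne : ((fun x : ℝ => |x - 1|) '' G.laplacianSpectrum).Nonempty :=
    ⟨_, 0, zero_mem_laplacianSpectrum hd hG, rfl⟩
  exact ⟨hne.csInf_mem hfin, fun _ hx => csInf_le hfin.bddBelow hx⟩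

theorem regular_subset_minDegreeGE (d : ℕ) : regular.{u} d ⊆ minDegreeGE d :=
  fun _ hG => ⟨hG.1, hG.2.1, fun v => (hG.2.2 v).ge⟩

/-- The supremum that defines the gap of a family is a genuine one. -/
theorem isLUB_familyGap {d : ℕ} (hd : 0 < d) {F : Set FiniteGraph.{u}} (hF : F ⊆ minDegreeGE d)
    (hne : F.Nonempty) : IsLUB (gap '' F) (familyGap F) := by
  refine isLUB_csSup (hne.image _) ⟨1, ?_⟩
  rintro _ ⟨G, hG, rfl⟩
  refine (isLeast_gap hd (hF hG)).2 ⟨0, zero_mem_laplacianSpectrum hd (hF hG), ?_⟩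
  norm_num

/-- There are `d`-regular graphs for every `d ≥ 2`: the complete ones on `d + 1` vertices. -/
theorem regular_nonempty {d : ℕ} (hd : 2 ≤ d) : (regular.{u} d).Nonempty := by
  classical
  refine ⟨⟨ULift (Fin (d + 1)), inferInstance, ⊤⟩, ?_, ?_, ?_⟩
  · exact SimpleGraph.connected_top
  · simp; omega
  · intro v
    have h := SimpleGraph.complete_graph_degree v
    simp only [Fintype.card_ulift, Fintype.card_fin, Nat.add_sub_cancel] at h
    convert h

end FiniteGraph

end

/-! Write `A` for the adjacency matrix, `D` for the degree matrix and `g` for the gap. Diagonalising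
the symmetric matrix similar to `D⁻¹A` gives `A D⁻¹ A ≥ g² D` as quadratic forms
(`sq_mul_le_of_spectrum`). Both the bound and the rigidity come from testing this inequality on
vectors of small support.

Upper bound. For every vertex `w` and every pair `u`, `v` of its neighbours, test with a weighted
difference of the two basis vectors. Averaging over all pairs and all `w` gives `mul_sum_degree_le`;
an elementary inequality in each degree then yields `g² ≤ (d-1)/d²`, with equality only for
`d`-regular graphs (`le_of_minDegree`).

Rigidity. If `G` is `d`-regular and `g > √(d-2)/d`, then `A² > d-2`. Differences of two basis
vectors show that distinct vertices have at most one common neighbour. Hence `A² = d + B`, with `B`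
the adjacency matrix of the collinearity graph `H`, and all eigenvalues of `H` exceed `-2`
(`gramPos_collinearityGraph`). So `2 + B` is a positive definite Gram matrix, as for root systems,
and any configuration producing a vector of nonpositive norm is impossible. As `H` is regular of
degree `d(d-1) ≥ 6`, this excludes induced claws (`GramPos.not_isClaw`), induced four-cycles, and
three common neighbours of a nonadjacent pair (`false_of_three_common`). Regard each vertex of `G`
both as a point and as a line, namely its neighbourhood, which is a clique of `H`. Incidence
arguments, separate for `d ≥ 4` and `d = 3`, then show that collinearity is transitive
(`IsTightSpace.adj_of_common`).

By connectedness there are at most two collinearity classes. A single class contradicts the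
friendship theorem (`IsLinearSpace.false_of_friendship`); two classes are the points and the lines
of a projective plane (`IsTightSpace.exists_projectivePlane`).

Conversely, for the incidence graph of a plane, `A²` is `d-1` plus two all-ones blocks, so every
eigenvalue of `A` has absolute value at least `√(d-1)`. -/

open Finset

/-! ### From the spectral gap to a quadratic form inequality. -/

section Spectral

variable {V : Type*} [Fintype V] (G : SimpleGraph V) [DecidableRel G.Adj]

lemma normalizedLaplacian_apply_eq (f : V → ℝ) (v : V) :
    normalizedLaplacian G f v = f v - (1 / (G.degree v : ℝ)) * ∑ w ∈ G.neighborFinset v, f w := rfl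

lemma sum_neighborFinset_comm (F : V → V → ℝ) :
    ∑ w, ∑ u ∈ G.neighborFinset w, F u w = ∑ u, ∑ w ∈ G.neighborFinset u, F u w := by
  refine Finset.sum_comm' fun x y => ?_
  simp [G.adj_comm]

/-- The symmetric matrix `𝐃^(-1/2) 𝐀 𝐃^(-1/2)`. -/
noncomputable def normalizedAdjMatrix : Matrix V V ℝ :=
  Matrix.of fun u v => (√(G.degree u))⁻¹ * G.adjMatrix ℝ u v * (√(G.degree v))⁻¹

lemma normalizedAdjMatrix_mulVec (f : V → ℝ) (u : V) :
    (normalizedAdjMatrix G).mulVec f u =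
      (√(G.degree u))⁻¹ * ∑ v ∈ G.neighborFinset u, (√(G.degree v))⁻¹ * f v := by
  simp only [Matrix.mulVec, dotProduct, normalizedAdjMatrix, Matrix.of_apply,
    SimpleGraph.adjMatrix_apply, mul_sum]
  rw [SimpleGraph.neighborFinset_eq_filter, sum_filter]
  refine sum_congr rfl fun v _ => ?_
  split_ifs <;> ring

lemma normalizedAdjMatrix_isSymm : (normalizedAdjMatrix G).transpose = normalizedAdjMatrix G := by
  ext u v
  simp [normalizedAdjMatrix, G.adj_comm v u]
  ring_nf

/-- Multiplication by `𝐃^(-1/2)` carries eigenvectors of the symmetric matrix to eigenvectors of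
`𝐃⁻¹𝐀`. -/
lemma exists_mem_spectrum_of_normalizedAdjMatrix (hdeg : ∀ v, 0 < G.degree v) {z : V → ℝ}
    (hz : z ≠ 0) {ε : ℝ} (h : (normalizedAdjMatrix G).mulVec z = ε • z) :
    1 - ε ∈ spectrum ℝ (normalizedLaplacian G) := by
  have hpos : ∀ v, 0 < √(G.degree v : ℝ) := fun v => Real.sqrt_pos.2 (by exact_mod_cast hdeg v)
  rw [← Module.End.hasEigenvalue_iff_mem_spectrum]
  refine Module.End.hasEigenvalue_of_hasEigenvector
    (x := fun v => (√(G.degree v : ℝ))⁻¹ * z v) ⟨?_, ?_⟩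
  · rw [Module.End.mem_eigenspace_iff]
    funext v
    have hv := congrFun h v
    rw [normalizedAdjMatrix_mulVec] at hv
    simp only [Pi.smul_apply, smul_eq_mul] at hv ⊢
    rw [normalizedLaplacian_apply_eq]
    have h2 : (1 : ℝ) / G.degree v = (√(G.degree v : ℝ))⁻¹ * (√(G.degree v : ℝ))⁻¹ := by
      rw [← mul_inv, Real.mul_self_sqrt (by positivity), one_div]
    rw [h2, mul_assoc, hv]
    ring
  · intro h0
    apply hz
    funext v
    have := congrFun h0 v
    simpa [(hpos v).ne'] using this

/-- If the spectrum of the normalized Laplacian stays away from `1` by `g`, then `𝐃⁻¹𝐀` expands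
the degree-weighted norm by at least the factor `g`. -/
theorem sq_mul_le_of_spectrum [DecidableEq V] (hdeg : ∀ v, 0 < G.degree v) {g : ℝ}
    (hg : ∀ μ ∈ spectrum ℝ (normalizedLaplacian G), g ≤ |μ - 1|) (hg0 : 0 ≤ g) (f : V → ℝ) :
    g ^ 2 * ∑ v, (G.degree v : ℝ) * f v ^ 2 ≤
      ∑ w, (1 / (G.degree w : ℝ)) * (∑ v ∈ G.neighborFinset w, f v) ^ 2 := by
  have hpos : ∀ v, 0 < √(G.degree v : ℝ) := fun v => Real.sqrt_pos.2 (by exact_mod_cast hdeg v)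
  set N := normalizedAdjMatrix G with hN
  have hsymm : N.transpose = N := normalizedAdjMatrix_isSymm G
  have hdot : ∀ a b : V → ℝ, dotProduct a (N.mulVec b) = dotProduct (N.mulVec a) b := by
    intro a b
    rw [Matrix.dotProduct_mulVec, ← Matrix.mulVec_transpose, hsymm]
  have hherm : (N * N - (g ^ 2) • (1 : Matrix V V ℝ)).IsHermitian := by
    rw [Matrix.IsHermitian, Matrix.conjTranspose_eq_transpose_of_trivial]
    simp [Matrix.transpose_mul, hsymm]
  have hmul : ∀ x : V → ℝ, (N * N - (g ^ 2) • (1 : Matrix V V ℝ)).mulVec x =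
      N.mulVec (N.mulVec x) - g ^ 2 • x := by
    intro x
    rw [Matrix.sub_mulVec, ← Matrix.mulVec_mulVec, Matrix.smul_mulVec, Matrix.one_mulVec]
  have hpsd : (N * N - (g ^ 2) • (1 : Matrix V V ℝ)).PosSemidef := by
    rw [hherm.posSemidef_iff_eigenvalues_nonneg]
    intro i
    by_contra! hneg
    simp only [Pi.zero_apply] at hneg
    set ν := hherm.eigenvalues i with hν
    set x : V → ℝ := (hherm.eigenvectorBasis i).ofLp with hx
    have hx0 : x ≠ 0 := by
      intro h0
      apply (hherm.eigenvectorBasis.orthonormal.ne_zero i)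
      ext v
      exact congrFun h0 v
    have hxe : N.mulVec (N.mulVec x) = (g ^ 2 + ν) • x := by
      have := hherm.mulVec_eigenvectorBasis i
      rw [hmul] at this
      rw [add_smul]
      exact sub_eq_iff_eq_add'.1 this
    have hxx : 0 < dotProduct x x := by
      have := Matrix.dotProduct_star_self_pos_iff.2 hx0
      simpa using this
    have hκ : 0 ≤ g ^ 2 + ν := by
      have h1 : dotProduct x (N.mulVec (N.mulVec x)) = dotProduct (N.mulVec x) (N.mulVec x) :=
        hdot _ _
      rw [hxe, dotProduct_smul, smul_eq_mul] at h1
      have h2 : 0 ≤ dotProduct (N.mulVec x) (N.mulVec x) :=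
        sum_nonneg fun v _ => mul_self_nonneg _
      by_contra! h3
      nlinarith
    set s := √(g ^ 2 + ν) with hs
    have hss : s * s = g ^ 2 + ν := Real.mul_self_sqrt hκ
    have hs0 : 0 ≤ s := Real.sqrt_nonneg _
    have hsg : s < g := by nlinarith
    -- Since `N² x = s² x`, the vector `N x + s x` is either zero, so that `-s` is an eigenvalue of
    -- `N`, or an eigenvector for `s`. Both contradict `s < g`.
    by_cases hz : N.mulVec x + s • x = 0
    · have h1 : N.mulVec x = (-s) • x := by
        rw [neg_smul]; exact eq_neg_of_add_eq_zero_left hz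
      have := hg _ (exists_mem_spectrum_of_normalizedAdjMatrix G hdeg hx0 h1)
      rw [show 1 - -s - 1 = s by ring, abs_of_nonneg hs0] at this
      linarith
    · have h1 : N.mulVec (N.mulVec x + s • x) = s • (N.mulVec x + s • x) := by
        rw [Matrix.mulVec_add, hxe, Matrix.mulVec_smul, smul_add, smul_smul, hss, add_comm]
      have := hg _ (exists_mem_spectrum_of_normalizedAdjMatrix G hdeg hz h1)
      rw [show 1 - s - 1 = -s by ring, abs_neg, abs_of_nonneg hs0] at this
      linarith
  set y : V → ℝ := fun v => √(G.degree v : ℝ) * f v with hy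
  have h1 := hpsd.dotProduct_mulVec_nonneg y
  rw [hmul, star_trivial, dotProduct_sub, hdot, dotProduct_smul, smul_eq_mul] at h1
  have h2 : dotProduct y y = ∑ v, (G.degree v : ℝ) * f v ^ 2 := by
    refine sum_congr rfl fun v _ => ?_
    have := Real.mul_self_sqrt (show (0 : ℝ) ≤ G.degree v by positivity)
    simp only [hy]
    linear_combination (f v) ^ 2 * this
  have h3 : dotProduct (N.mulVec y) (N.mulVec y) =
      ∑ w, (1 / (G.degree w : ℝ)) * (∑ v ∈ G.neighborFinset w, f v) ^ 2 := by
    refine sum_congr rfl fun w _ => ?_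
    rw [hN, normalizedAdjMatrix_mulVec]
    have h4 : ∑ v ∈ G.neighborFinset w, (√(G.degree v : ℝ))⁻¹ * y v =
        ∑ v ∈ G.neighborFinset w, f v := by
      refine sum_congr rfl fun v _ => ?_
      simp only [hy]
      rw [← mul_assoc, inv_mul_cancel₀ (hpos v).ne', one_mul]
    have h5 : (1 : ℝ) / G.degree w = (√(G.degree w : ℝ))⁻¹ * (√(G.degree w : ℝ))⁻¹ := by
      rw [← mul_inv, Real.mul_self_sqrt (by positivity), one_div]
    rw [h4, h5]
    ring
  rw [h2, h3] at h1
  linarith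

end Spectral

/-! ### The upper bound under a minimum degree condition. -/

section MinDegree

/-- The sum of the hypothesis over all ordered pairs is `#S - 1` times the conclusion. -/
lemma two_mul_sum_add_nonneg {ι : Type*} [DecidableEq ι] (S : Finset ι) (g : ι → ℝ) (c : ℝ)
    (hS : 2 ≤ #S) (h : ∀ u ∈ S, ∀ v ∈ S, u ≠ v → 0 ≤ g u + g v + c) :
    0 ≤ 2 * ∑ u ∈ S, g u + #S * c := by
  have h1 : 0 ≤ ∑ u ∈ S, ∑ v ∈ S.erase u, (g u + g v + c) :=
    sum_nonneg fun u hu => sum_nonneg fun v hv =>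
      h u hu v (mem_of_mem_erase hv) (ne_of_mem_erase hv).symm
  have h2 : ∑ u ∈ S, ∑ v ∈ S.erase u, (g u + g v + c) =
      ((#S : ℝ) - 1) * (2 * ∑ u ∈ S, g u + #S * c) := by
    have h3 : ∀ u ∈ S, ∑ v ∈ S.erase u, (g u + g v + c) =
        ((#S : ℝ) - 1) * (g u + c) + (∑ v ∈ S, g v - g u) := by
      intro u hu
      have h4 : (#(S.erase u) : ℝ) = #S - 1 := by
        rw [card_erase_of_mem hu, Nat.cast_sub (by omega), Nat.cast_one]
      have h5 := add_sum_erase S g hu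
      rw [sum_add_distrib, sum_add_distrib, sum_const, sum_const, nsmul_eq_mul, nsmul_eq_mul, h4]
      linarith
    rw [sum_congr rfl h3, sum_add_distrib, ← mul_sum, sum_add_distrib, sum_sub_distrib, sum_const,
      sum_const, nsmul_eq_mul, nsmul_eq_mul]
    ring
  rw [h2] at h1
  have h3 : (0 : ℝ) < #S - 1 := by
    have : (2 : ℝ) ≤ #S := by exact_mod_cast hS
    linarith
  exact nonneg_of_mul_nonneg_right h1 h3

/-- With `x = a²` and `d = b²` the difference of the two sides is `(a - b)((b² - 1)(a + b) - 2a)`,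
and the second factor is positive because `b² ≥ 3`. -/
lemma two_mul_mul_one_sub_sqrt_le {d x : ℝ} (hd : 3 ≤ d) (hx : d ≤ x) :
    2 * x * (1 - √(d / x)) ≤ (d - 1) * (x - d) := by
  have hx0 : 0 < x := by linarith
  obtain ⟨a, ha, rfl⟩ : ∃ a, 0 < a ∧ x = a ^ 2 :=
    ⟨√x, Real.sqrt_pos.2 hx0, (Real.sq_sqrt hx0.le).symm⟩
  obtain ⟨b, hb, rfl⟩ : ∃ b, 0 < b ∧ d = b ^ 2 :=
    ⟨√d, Real.sqrt_pos.2 (by linarith), (Real.sq_sqrt (by linarith)).symm⟩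
  have hab : b ≤ a := by nlinarith
  rw [← div_pow, Real.sqrt_sq (by positivity)]
  have h1 : 2 * a ^ 2 * (1 - b / a) = 2 * a * (a - b) := by field_simp
  rw [h1]
  nlinarith [mul_nonneg (sub_nonneg.2 hab) (by nlinarith : 0 ≤ (b ^ 2 - 1) * (a + b) - 2 * a)]

lemma two_mul_mul_one_sub_sqrt_lt {d x : ℝ} (hd : 3 ≤ d) (hx : d < x) :
    2 * x * (1 - √(d / x)) < (d - 1) * (x - d) := by
  have hx0 : 0 < x := by linarith
  obtain ⟨a, ha, rfl⟩ : ∃ a, 0 < a ∧ x = a ^ 2 :=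
    ⟨√x, Real.sqrt_pos.2 hx0, (Real.sq_sqrt hx0.le).symm⟩
  obtain ⟨b, hb, rfl⟩ : ∃ b, 0 < b ∧ d = b ^ 2 :=
    ⟨√d, Real.sqrt_pos.2 (by linarith), (Real.sq_sqrt (by linarith)).symm⟩
  have hab : b < a := by nlinarith
  rw [← div_pow, Real.sqrt_sq (by positivity)]
  have h1 : 2 * a ^ 2 * (1 - b / a) = 2 * a * (a - b) := by field_simp
  rw [h1]
  nlinarith [mul_pos (sub_pos.2 hab) (by nlinarith : 0 < (b ^ 2 - 1) * (a + b) - 2 * a)]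

variable {V : Type*} [Fintype V] [DecidableEq V] (G : SimpleGraph V) [DecidableRel G.Adj]

/-- The diagonal of `𝐀 𝐃⁻¹ 𝐀`. -/
noncomputable def invDegreeSum (u : V) : ℝ := ∑ w ∈ G.neighborFinset u, 1 / (G.degree w : ℝ)

/-- Each common neighbour `w'` of `u` and `v` contributes a cross term `-2αβ / deg w'`; all of them
except that of `w` are dropped. -/
lemma sum_sq_single_sub_single_le {u v w : V} (hu : u ∈ G.neighborFinset w)
    (hv : v ∈ G.neighborFinset w) {α β : ℝ} (hα : 0 ≤ α) (hβ : 0 ≤ β) :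
    ∑ w', (1 / (G.degree w' : ℝ)) *
      (∑ x ∈ G.neighborFinset w', (Pi.single u α - Pi.single v β : V → ℝ) x) ^ 2 ≤
    α ^ 2 * invDegreeSum G u + β ^ 2 * invDegreeSum G v - 2 * α * β / G.degree w := by
  set F : V → ℝ := fun w' => (1 / (G.degree w' : ℝ)) *
    ((if u ∈ G.neighborFinset w' then 1 else 0) * (if v ∈ G.neighborFinset w' then 1 else 0)) with hF
  have h1 : ∀ w', (1 / (G.degree w' : ℝ)) *
      (∑ x ∈ G.neighborFinset w', (Pi.single u α - Pi.single v β : V → ℝ) x) ^ 2 =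
      α ^ 2 * (if w' ∈ G.neighborFinset u then 1 / (G.degree w' : ℝ) else 0) +
      β ^ 2 * (if w' ∈ G.neighborFinset v then 1 / (G.degree w' : ℝ) else 0) -
      2 * α * β * F w' := by
    intro w'
    simp only [Pi.sub_apply, sum_sub_distrib, Finset.sum_pi_single', hF,
      SimpleGraph.mem_neighborFinset, G.adj_comm u, G.adj_comm v]
    split_ifs <;> ring
  have h2 : 1 / (G.degree w : ℝ) ≤ ∑ w', F w' := by
    have : F w ≤ ∑ w', F w' := single_le_sum (f := F) (fun x _ => by
      simp only [hF]; positivity) (mem_univ w)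
    simpa [hF, hu, hv, -SimpleGraph.mem_neighborFinset] using this
  rw [sum_congr rfl fun w' _ => h1 w', sum_sub_distrib, sum_add_distrib, ← mul_sum, ← mul_sum,
    ← mul_sum, sum_ite_mem, sum_ite_mem, univ_inter, univ_inter]
  have h3 := mul_le_mul_of_nonneg_left h2 (by positivity : 0 ≤ 2 * α * β)
  have h4 : 2 * α * β * (1 / (G.degree w : ℝ)) = 2 * α * β / G.degree w := by ring
  rw [h4] at h3
  unfold invDegreeSum
  linarith

/-- The main averaging inequality: if `𝐀 𝐃⁻¹ 𝐀 ≥ γ 𝐃` and all degrees are at least `d`, then `γ` is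
bounded by a sum over the vertices. -/
theorem mul_sum_degree_le {d : ℕ} (hd : 3 ≤ d) (hdeg : ∀ v, d ≤ G.degree v) {γ : ℝ}
    (h : ∀ f : V → ℝ, γ * ∑ v, (G.degree v : ℝ) * f v ^ 2 ≤
      ∑ w, (1 / (G.degree w : ℝ)) * (∑ v ∈ G.neighborFinset w, f v) ^ 2) :
    γ * ∑ v, (G.degree v : ℝ) ≤ Fintype.card V * (1 - 1 / (d : ℝ)) +
      (1 / (d : ℝ) ^ 2) * ∑ v, 2 * (G.degree v : ℝ) * (1 - √(d / G.degree v)) := by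
  have hd0 : (0 : ℝ) < d := by exact_mod_cast (by omega : 0 < d)
  have hdeg' : ∀ v, (d : ℝ) ≤ G.degree v := fun v => by exact_mod_cast hdeg v
  have hdeg0 : ∀ v, (0 : ℝ) < G.degree v := fun v => hd0.trans_le (hdeg' v)
  -- With this scaling, `s u` times the basis vector at `u` has degree-weighted square norm `d`,
  -- whatever the degree of `u`.
  set s : V → ℝ := fun u => √(d / G.degree u) with hs
  have hs0 : ∀ u, 0 ≤ s u := fun u => Real.sqrt_nonneg _
  have hs1 : ∀ u, s u ≤ 1 := fun u => by
    exact Real.sqrt_le_one.2 ((div_le_one (hdeg0 u)).2 (hdeg' u))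
  have hsq : ∀ u, s u ^ 2 = d / G.degree u := fun u =>
    Real.sq_sqrt (div_nonneg hd0.le (hdeg0 u).le)
  set y : V → ℝ := fun u => invDegreeSum G u / G.degree u with hy
  have key : ∀ w, 0 ≤ ∑ u ∈ G.neighborFinset w,
      (y u - γ - 2 / (d * G.degree w) * s u) + 1 / d := by
    intro w
    have h1 := two_mul_sum_add_nonneg (G.neighborFinset w)
      (fun u => y u - γ - 2 / (d * G.degree w) * s u) (2 / (d * G.degree w))
      (by rw [SimpleGraph.card_neighborFinset_eq_degree]; have := hdeg w; omega) ?_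
    · rw [SimpleGraph.card_neighborFinset_eq_degree] at h1
      have h2 : (G.degree w : ℝ) * (2 / (d * G.degree w)) = 2 * (1 / d) := by
        have := (hdeg0 w).ne'
        field_simp
      rw [h2] at h1
      linarith
    · intro u hu v hv huv
      have h1 := (h _).trans (sum_sq_single_sub_single_le G hu hv (hs0 u) (hs0 v))
      have h2 : ∑ x, (G.degree x : ℝ) * (Pi.single u (s u) - Pi.single v (s v) : V → ℝ) x ^ 2 =
          2 * d := by
        have h3 : ∀ x, (G.degree x : ℝ) * (Pi.single u (s u) - Pi.single v (s v) : V → ℝ) x ^ 2 =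
            (Pi.single u (d : ℝ) : V → ℝ) x + (Pi.single v (d : ℝ) : V → ℝ) x := by
          intro x
          simp only [Pi.sub_apply]
          rcases eq_or_ne x u with rfl | hxu
          · have := (hdeg0 x).ne'
            simp [huv, hsq]
            field_simp
          · rcases eq_or_ne x v with rfl | hxv
            · have := (hdeg0 x).ne'
              simp [hxu, hsq]
              field_simp
            · simp [hxu, hxv]
        rw [sum_congr rfl fun x _ => h3 x, sum_add_distrib, sum_pi_single', sum_pi_single']
        simp
        ring
      rw [h2, hsq, hsq] at h1
      have h3 : (d : ℝ) / G.degree u * invDegreeSum G u = d * y u := by simp only [hy]; ring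
      have h4 : (d : ℝ) / G.degree v * invDegreeSum G v = d * y v := by simp only [hy]; ring
      rw [h3, h4] at h1
      -- This is `(1 - s u)(1 - s v) ≥ 0`. It replaces the product by a sum of terms in `u` and in
      -- `v`, so that summing over pairs decouples.
      have h5 : (s u + s v - 1) ≤ s u * s v := by nlinarith [hs1 u, hs1 v]
      have h6 : 2 * (s u + s v - 1) / G.degree w ≤ 2 * s u * s v / G.degree w :=
        div_le_div_of_nonneg_right (by linarith) (hdeg0 w).le
      have h7 : 2 / ((d : ℝ) * G.degree w) * (s u + s v - 1) =
          2 * (s u + s v - 1) / G.degree w / d := by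
        have := (hdeg0 w).ne'
        field_simp
      have h8 : 2 * (s u + s v - 1) / G.degree w / d ≤ y u + y v - 2 * γ := by
        rw [div_le_iff₀ hd0]
        linarith
      rw [← h7] at h8
      linarith
  have hQ : ∀ u, invDegreeSum G u ≤ G.degree u / d := by
    intro u
    have : ∑ w ∈ G.neighborFinset u, 1 / (G.degree w : ℝ) ≤ ∑ w ∈ G.neighborFinset u, 1 / (d : ℝ) :=
      sum_le_sum fun w _ => one_div_le_one_div_of_le hd0 (hdeg' w)
    rw [sum_const, SimpleGraph.card_neighborFinset_eq_degree, nsmul_eq_mul, mul_one_div] at this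
    exact this
  have hQsum : ∑ u, invDegreeSum G u = Fintype.card V := by
    have h1 : ∑ u, invDegreeSum G u =
        ∑ w, ∑ u ∈ G.neighborFinset w, 1 / (G.degree w : ℝ) :=
      (sum_neighborFinset_comm G fun _ w => 1 / (G.degree w : ℝ)).symm
    rw [h1, sum_congr rfl (g := fun _ => (1 : ℝ)) fun w _ => ?_]
    · simp
    · rw [sum_const, SimpleGraph.card_neighborFinset_eq_degree, nsmul_eq_mul,
        mul_one_div_cancel (hdeg0 w).ne']
  have h1 : 0 ≤ ∑ w, (∑ u ∈ G.neighborFinset w,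
      (y u - γ - 2 / (d * G.degree w) * s u) + 1 / d) := sum_nonneg fun w _ => key w
  rw [sum_add_distrib, sum_neighborFinset_comm G
    fun u w => y u - γ - 2 / (d * G.degree w) * s u] at h1
  have h2 : ∀ u, ∑ w ∈ G.neighborFinset u, (y u - γ - 2 / (d * G.degree w) * s u) =
      invDegreeSum G u - γ * G.degree u - 2 / d * (s u * invDegreeSum G u) := by
    intro u
    rw [sum_sub_distrib, sum_const, SimpleGraph.card_neighborFinset_eq_degree, nsmul_eq_mul,
      ← sum_mul]
    have h3 : ∑ w ∈ G.neighborFinset u, 2 / ((d : ℝ) * G.degree w) = 2 / d * invDegreeSum G u := by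
      rw [invDegreeSum, mul_sum]
      refine sum_congr rfl fun w _ => ?_
      rw [div_mul_div_comm, mul_one]
    have h4 : (G.degree u : ℝ) * y u = invDegreeSum G u := mul_div_cancel₀ _ (hdeg0 u).ne'
    rw [h3]
    linear_combination h4
  rw [sum_congr rfl fun u _ => h2 u, sum_sub_distrib, sum_sub_distrib, hQsum, ← mul_sum,
    ← mul_sum] at h1
  -- Write `s = 1 - (1 - s)`: the sum of `invDegreeSum` is known exactly, and the pointwise bound
  -- `hQ` is needed only for the defect `1 - s`, which vanishes at degree `d`.
  have h5 : (Fintype.card V : ℝ) - (1 / (2 * d)) * ∑ v, 2 * (G.degree v : ℝ) * (1 - s v) ≤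
      ∑ u, s u * invDegreeSum G u := by
    rw [← hQsum, mul_sum, ← sum_sub_distrib]
    refine sum_le_sum fun u _ => ?_
    have h6 := mul_le_mul_of_nonneg_left (hQ u) (sub_nonneg.2 (hs1 u))
    have h7 : 1 / (2 * (d : ℝ)) * (2 * G.degree u * (1 - s u)) = (1 - s u) * (G.degree u / d) := by
      field_simp
    rw [h7]
    linarith
  have h8 := mul_le_mul_of_nonneg_left h5 (by positivity : 0 ≤ 2 / (d : ℝ))
  have h9 : 2 / (d : ℝ) * (Fintype.card V -
      1 / (2 * d) * ∑ v, 2 * (G.degree v : ℝ) * (1 - s v)) =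
      2 * (Fintype.card V * (1 / d)) - 1 / d ^ 2 * ∑ v, 2 * (G.degree v : ℝ) * (1 - s v) := by
    field_simp
  rw [h9] at h8
  rw [sum_const, card_univ, nsmul_eq_mul] at h1
  linarith

variable [Nonempty V]

/-- Bounding each summand of `mul_sum_degree_le` linearly in the degree makes the right-hand side
exactly `(d-1)/d²` times the degree sum. The bound is strict at every degree above `d`, whence the
equality case. -/
theorem le_of_minDegree {d : ℕ} (hd : 3 ≤ d) (hdeg : ∀ v, d ≤ G.degree v) {γ : ℝ}
    (h : ∀ f : V → ℝ, γ * ∑ v, (G.degree v : ℝ) * f v ^ 2 ≤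
      ∑ w, (1 / (G.degree w : ℝ)) * (∑ v ∈ G.neighborFinset w, f v) ^ 2) :
    γ ≤ ((d : ℝ) - 1) / d ^ 2 ∧ (γ = ((d : ℝ) - 1) / d ^ 2 → ∀ v, G.degree v = d) := by
  have hd0 : (0 : ℝ) < d := by exact_mod_cast (by omega : 0 < d)
  have hd3 : (3 : ℝ) ≤ d := by exact_mod_cast hd
  have hdeg' : ∀ v, (d : ℝ) ≤ G.degree v := fun v => by exact_mod_cast hdeg v
  have h1 := mul_sum_degree_le G hd hdeg h
  have hS : 0 < ∑ v, (G.degree v : ℝ) :=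
    sum_pos (fun v _ => hd0.trans_le (hdeg' v)) univ_nonempty
  have h2 : ∑ v, ((d : ℝ) - 1) * (G.degree v - d) =
      (d - 1) * ∑ v, (G.degree v : ℝ) - (d - 1) * (Fintype.card V * d) := by
    rw [← mul_sum, sum_sub_distrib, sum_const, card_univ, nsmul_eq_mul]
    ring
  have h3 : (Fintype.card V : ℝ) * (1 - 1 / d) + 1 / (d : ℝ) ^ 2 *
      ((d - 1) * ∑ v, (G.degree v : ℝ) - (d - 1) * (Fintype.card V * d)) =
      ((d : ℝ) - 1) / d ^ 2 * ∑ v, (G.degree v : ℝ) := by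
    field_simp
    ring
  have hpos : 0 < 1 / (d : ℝ) ^ 2 := by positivity
  refine ⟨?_, fun hγ => ?_⟩
  · have h4 : ∑ v, 2 * (G.degree v : ℝ) * (1 - √(d / G.degree v)) ≤
        ∑ v, ((d : ℝ) - 1) * (G.degree v - d) :=
      sum_le_sum fun v _ => two_mul_mul_one_sub_sqrt_le hd3 (hdeg' v)
    rw [h2] at h4
    have h5 := mul_le_mul_of_nonneg_left h4 hpos.le
    refine le_of_mul_le_mul_right ?_ hS
    linarith
  · by_contra! hne
    obtain ⟨v₀, hv₀⟩ := hne
    have h4 : ∑ v, 2 * (G.degree v : ℝ) * (1 - √(d / G.degree v)) <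
        ∑ v, ((d : ℝ) - 1) * (G.degree v - d) := by
      refine sum_lt_sum (fun v _ => two_mul_mul_one_sub_sqrt_le hd3 (hdeg' v))
        ⟨v₀, mem_univ _, two_mul_mul_one_sub_sqrt_lt hd3 ?_⟩
      exact_mod_cast lt_of_le_of_ne (hdeg v₀) (Ne.symm hv₀)
    rw [h2] at h4
    have h5 := mul_lt_mul_of_pos_left h4 hpos
    rw [hγ] at h1
    linarith

end MinDegree

/-! ### Projection away from an orthogonal system. -/

section Residual

variable {E : Type*} [AddCommGroup E] [Module ℝ E] (B : LinearMap.BilinForm ℝ E)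
  {ι : Type*} [Fintype ι]

/-- The component of `x` orthogonal to the pairwise orthogonal vectors `b i` of square norm `c`. -/
noncomputable def orthResidual (b : ι → E) (c : ℝ) (x : E) : E := x - ∑ i, (B x (b i) / c) • b i

variable [DecidableEq ι]

/-- The residual of `y` is orthogonal to every `b i`, so the projected part of `x` contributes
nothing. In the applications the right-hand side depends only on adjacencies. -/
lemma orthResidual_orthResidual {b : ι → E} {c : ℝ} (hc : c ≠ 0)
    (hb : ∀ i j, B (b i) (b j) = if i = j then c else 0) (x y : E)
    (hy : ∀ i, B (b i) y = B y (b i)) :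
    B (orthResidual B b c x) (orthResidual B b c y) = B x y - (∑ i, B x (b i) * B y (b i)) / c := by
  have h1 : ∀ i, B (b i) (orthResidual B b c y) = 0 := by
    intro i
    simp only [orthResidual, map_sub, map_sum, map_smul, hb, smul_eq_mul, hy]
    simp [hc]
  have h2 : B (orthResidual B b c x) (orthResidual B b c y) = B x (orthResidual B b c y) := by
    conv_lhs => rw [orthResidual]
    simp [LinearMap.sub_apply, LinearMap.sum_apply, h1]
  rw [h2]
  simp only [orthResidual, map_sub, map_sum, map_smul, smul_eq_mul]
  rw [sum_div]
  congr 1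
  refine sum_congr rfl fun i _ => ?_
  ring

end Residual

/-! ### Graphs with least eigenvalue larger than `-2`. -/

section Gram

/-- The indicator of adjacency. -/
noncomputable def adjInd {V : Type*} (H : SimpleGraph V) [DecidableRel H.Adj] (u v : V) : ℝ :=
  if H.Adj u v then 1 else 0

lemma adjInd_eq_zero_or_one {V : Type*} (H : SimpleGraph V) [DecidableRel H.Adj] (u v : V) :
    adjInd H u v = 0 ∨ adjInd H u v = 1 := by
  unfold adjInd; split_ifs <;> simp

lemma adjInd_comm {V : Type*} (H : SimpleGraph V) [DecidableRel H.Adj] (u v : V) :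
    adjInd H u v = adjInd H v u := by
  simp [adjInd, H.adj_comm]

/-- The standard basis vectors of `V → ℝ`. -/
def stdVec {V : Type*} [DecidableEq V] (v : V) : V → ℝ := Pi.single v 1

lemma stdVec_self {V : Type*} [DecidableEq V] (v : V) : stdVec v v = 1 := by simp [stdVec]

lemma stdVec_of_ne {V : Type*} [DecidableEq V] {u v : V} (h : u ≠ v) : stdVec v u = 0 := by
  simp [stdVec, h]

lemma sum_adjInd {V : Type*} [Fintype V] (H : SimpleGraph V) [DecidableRel H.Adj] {k : ℕ} (hk : H.IsRegularOfDegree k) (p : V) : ∑ t, adjInd H t p = k := by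
  simp only [adjInd, sum_boole]
  rw [← hk p, ← SimpleGraph.card_neighborFinset_eq_degree, SimpleGraph.neighborFinset_eq_filter]
  simp [H.adj_comm]

variable {V : Type*} [Fintype V] [DecidableEq V] (H : SimpleGraph V) [DecidableRel H.Adj]

/-- The bilinear form with matrix `2 + A`, where `A` is the adjacency matrix of `H`. -/
noncomputable def gramForm : LinearMap.BilinForm ℝ (V → ℝ) :=
  Matrix.toBilin' ((2 : ℝ) • (1 : Matrix V V ℝ) + H.adjMatrix ℝ)

/-- All eigenvalues of the adjacency matrix are larger than `-2`. -/
def GramPos : Prop := ∀ f : V → ℝ, f ≠ 0 → 0 < gramForm H f f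

lemma gramForm_self (v : V) : gramForm H (stdVec v) (stdVec v) = 2 := by
  rw [gramForm, stdVec, Matrix.toBilin'_single, Matrix.add_apply, Matrix.smul_apply,
    Matrix.one_apply_eq]
  simp

lemma gramForm_of_ne {u v : V} (h : u ≠ v) :
    gramForm H (stdVec u) (stdVec v) = adjInd H u v := by
  rw [gramForm, stdVec, stdVec, Matrix.toBilin'_single, Matrix.add_apply, Matrix.smul_apply,
    Matrix.one_apply_ne h]
  simp [adjInd, SimpleGraph.adjMatrix_apply]

lemma gramForm_of_adj {u v : V} (h : H.Adj u v) : gramForm H (stdVec u) (stdVec v) = 1 := by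
  rw [gramForm_of_ne H h.ne, adjInd, if_pos h]

lemma gramForm_of_not_adj {u v : V} (h : u ≠ v) (h' : ¬ H.Adj u v) :
    gramForm H (stdVec u) (stdVec v) = 0 := by
  rw [gramForm_of_ne H h, adjInd, if_neg h']

lemma gramForm_comm (f g : V → ℝ) : gramForm H f g = gramForm H g f := by
  have h : ((2 : ℝ) • (1 : Matrix V V ℝ) + H.adjMatrix ℝ).transpose =
      (2 : ℝ) • (1 : Matrix V V ℝ) + H.adjMatrix ℝ := by simp
  rw [gramForm, Matrix.toBilin'_apply', Matrix.toBilin'_apply', Matrix.dotProduct_mulVec,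
    ← Matrix.mulVec_transpose, h, dotProduct_comm]

variable {H}

lemma GramPos.pos_of_apply_eq_one (hH : GramPos H) {f : V → ℝ} {v : V} (h : f v = 1) :
    0 < gramForm H f f := by
  refine hH f ?_
  rintro rfl
  simp at h

/-- There is no induced cycle of length four. -/
lemma GramPos.adj_of_square (hH : GramPos H) {p q r s : V} (hpq : p ≠ q) (hpq' : ¬ H.Adj p q)
    (hrs : r ≠ s) (hrp : H.Adj r p) (hrq : H.Adj r q) (hsp : H.Adj s p) (hsq : H.Adj s q) :
    H.Adj r s := by
  by_contra hrs'
  -- The alternating vector on an induced four-cycle has norm `8 - 8 = 0`.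
  have h1 : (stdVec p + stdVec q - stdVec r - stdVec s : V → ℝ) p = 1 := by
    simp [stdVec_self, stdVec_of_ne hpq, stdVec_of_ne hrp.ne.symm, stdVec_of_ne hsp.ne.symm]
  have h2 := hH.pos_of_apply_eq_one h1
  simp only [map_add, map_sub, LinearMap.add_apply, LinearMap.sub_apply, gramForm_self,
    gramForm_of_adj H hrp, gramForm_of_adj H hrq, gramForm_of_adj H hsp, gramForm_of_adj H hsq,
    gramForm_of_adj H hrp.symm, gramForm_of_adj H hrq.symm, gramForm_of_adj H hsp.symm,
    gramForm_of_adj H hsq.symm, gramForm_of_not_adj H hpq hpq', gramForm_of_not_adj H hrs hrs',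
    gramForm_of_not_adj H hpq.symm fun h => hpq' h.symm,
    gramForm_of_not_adj H hrs.symm fun h => hrs' h.symm] at h2
  norm_num at h2

/-- Two triangles `a b u` and `c e v` on opposite edges of a clique `a b c e` do not occur. -/
lemma GramPos.false_of_two_triangles (hH : GramPos H) {a b c e u v : V}
    (hab : H.Adj a b) (hac : H.Adj a c) (hae : H.Adj a e) (hbc : H.Adj b c) (hbe : H.Adj b e)
    (hce : H.Adj c e) (hua : H.Adj u a) (hub : H.Adj u b) (hvc : H.Adj v c) (hve : H.Adj v e)
    (huc : ¬ H.Adj u c) (hue : ¬ H.Adj u e) (hva : ¬ H.Adj v a) (hvb : ¬ H.Adj v b) : False := by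
  have huc' : u ≠ c := by rintro rfl; exact hue hce
  have hue' : u ≠ e := by rintro rfl; exact huc hce.symm
  have hva' : v ≠ a := by rintro rfl; exact hvb hab
  have hvb' : v ≠ b := by rintro rfl; exact hva hab.symm
  have huv' : u ≠ v := by rintro rfl; exact huc hvc
  -- The norm of this vector is `-2` if `u` and `v` are adjacent and `0` otherwise.
  have h1 : (stdVec a + stdVec b - stdVec u - stdVec c - stdVec e + stdVec v : V → ℝ) a = 1 := by
    simp [stdVec_self, stdVec_of_ne hab.ne, stdVec_of_ne hua.ne.symm, stdVec_of_ne hac.ne,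
      stdVec_of_ne hae.ne, stdVec_of_ne hva'.symm]
  have h2 := hH.pos_of_apply_eq_one h1
  simp only [map_add, map_sub, LinearMap.add_apply, LinearMap.sub_apply, gramForm_self,
    gramForm_of_adj H hab, gramForm_of_adj H hab.symm, gramForm_of_adj H hac,
    gramForm_of_adj H hac.symm, gramForm_of_adj H hae, gramForm_of_adj H hae.symm,
    gramForm_of_adj H hbc, gramForm_of_adj H hbc.symm, gramForm_of_adj H hbe,
    gramForm_of_adj H hbe.symm, gramForm_of_adj H hce, gramForm_of_adj H hce.symm,
    gramForm_of_adj H hua, gramForm_of_adj H hua.symm, gramForm_of_adj H hub,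
    gramForm_of_adj H hub.symm, gramForm_of_adj H hvc, gramForm_of_adj H hvc.symm,
    gramForm_of_adj H hve, gramForm_of_adj H hve.symm,
    gramForm_of_not_adj H huc' huc, gramForm_of_not_adj H huc'.symm fun h => huc h.symm,
    gramForm_of_not_adj H hue' hue, gramForm_of_not_adj H hue'.symm fun h => hue h.symm,
    gramForm_of_not_adj H hva' hva, gramForm_of_not_adj H hva'.symm fun h => hva h.symm,
    gramForm_of_not_adj H hvb' hvb, gramForm_of_not_adj H hvb'.symm fun h => hvb h.symm,
    gramForm_of_ne H huv', gramForm_of_ne H huv'.symm] at h2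
  rcases adjInd_eq_zero_or_one H u v with h | h <;>
    rw [adjInd_comm H v u, h] at h2 <;> norm_num at h2

end Gram

/-! ### Excluding induced claws. -/

section Claw

variable {V : Type*} [Fintype V] [DecidableEq V] {H : SimpleGraph V} [DecidableRel H.Adj]

/-- The vertices `p`, `q`, `s` are the leaves of an induced claw with centre `r`. -/
structure IsClaw (H : SimpleGraph V) (p q s r : V) : Prop where
  pq : p ≠ q
  ps : p ≠ s
  qs : q ≠ s
  rp : H.Adj r p
  rq : H.Adj r q
  rs : H.Adj r s
  npq : ¬ H.Adj p q
  nps : ¬ H.Adj p s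
  nqs : ¬ H.Adj q s

omit [Fintype V] [DecidableEq V] [DecidableRel H.Adj] in
lemma IsClaw.swap_right {p q s r : V} (h : IsClaw H p q s r) : IsClaw H p s q r :=
  ⟨h.ps, h.pq, h.qs.symm, h.rp, h.rs, h.rq, h.nps, h.npq, fun h' => h.nqs h'.symm⟩

omit [Fintype V] [DecidableEq V] [DecidableRel H.Adj] in
lemma IsClaw.swap_left {p q s r : V} (h : IsClaw H p q s r) : IsClaw H q p s r :=
  ⟨h.pq.symm, h.qs, h.ps, h.rq, h.rp, h.rs, fun h' => h.npq h'.symm, h.nqs, h.nps⟩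

/-- Four pairwise orthogonal vectors in the span of an induced claw. -/
def clawBasis (p q s r : V) : Fin 4 → V → ℝ :=
  ![stdVec p, stdVec q, stdVec s, stdVec p + stdVec q + stdVec s - (2 : ℝ) • stdVec r]

lemma IsClaw.gramForm_clawBasis {p q s r : V} (h : IsClaw H p q s r) (i j : Fin 4) :
    gramForm H (clawBasis p q s r i) (clawBasis p q s r j) = if i = j then 2 else 0 := by
  have e1 := gramForm_of_not_adj H h.pq h.npq
  have e2 := gramForm_of_not_adj H h.ps h.nps
  have e3 := gramForm_of_not_adj H h.qs h.nqs
  have e4 := gramForm_of_not_adj H h.pq.symm fun h' => h.npq h'.symm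
  have e5 := gramForm_of_not_adj H h.ps.symm fun h' => h.nps h'.symm
  have e6 := gramForm_of_not_adj H h.qs.symm fun h' => h.nqs h'.symm
  have e7 := gramForm_of_adj H h.rp
  have e8 := gramForm_of_adj H h.rq
  have e9 := gramForm_of_adj H h.rs
  have e10 := gramForm_of_adj H h.rp.symm
  have e11 := gramForm_of_adj H h.rq.symm
  have e12 := gramForm_of_adj H h.rs.symm
  fin_cases i <;> fin_cases j <;>
    simp only [clawBasis, Fin.zero_eta, Fin.mk_one, Fin.reduceFinMk, Matrix.cons_val, map_add,
      map_sub, map_smul, LinearMap.add_apply, LinearMap.sub_apply, LinearMap.smul_apply,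
      gramForm_self, smul_eq_mul, e1, e2, e3, e4, e5, e6, e7, e8, e9, e10, e11, e12] <;>
    simp; norm_num

omit [Fintype V] in
lemma clawBasis_apply {p q s r t : V} (ht : t ∉ ({p, q, s, r} : Finset V)) (i : Fin 4) :
    clawBasis p q s r i t = 0 := by
  simp only [mem_insert, mem_singleton, not_or] at ht
  obtain ⟨h1, h2, h3, h4⟩ := ht
  fin_cases i <;>
    simp [clawBasis, stdVec_of_ne h1, stdVec_of_ne h2, stdVec_of_ne h3, stdVec_of_ne h4]

/-- The component of a basis vector orthogonal to an induced claw. -/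
noncomputable def clawResidual (H : SimpleGraph V) [DecidableRel H.Adj] (p q s r t : V) : V → ℝ :=
  orthResidual (gramForm H) (clawBasis p q s r) 2 (stdVec t)

lemma clawResidual_apply {p q s r t : V} (u : V) (ht : t ∉ ({p, q, s, r} : Finset V)) :
    clawResidual H p q s r u t = stdVec u t := by
  simp [clawResidual, orthResidual, Finset.sum_apply, clawBasis_apply ht]

lemma IsClaw.gramForm_clawResidual {p q s r : V} (h : IsClaw H p q s r) {t u : V}
    (ht : t ∉ ({p, q, s, r} : Finset V)) (hu : u ∉ ({p, q, s, r} : Finset V)) :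
    gramForm H (clawResidual H p q s r t) (clawResidual H p q s r u) =
      gramForm H (stdVec t) (stdVec u) -
      (adjInd H t p * adjInd H u p + adjInd H t q * adjInd H u q + adjInd H t s * adjInd H u s +
        (adjInd H t p + adjInd H t q + adjInd H t s - 2 * adjInd H t r) *
        (adjInd H u p + adjInd H u q + adjInd H u s - 2 * adjInd H u r)) / 2 := by
  simp only [mem_insert, mem_singleton, not_or] at ht hu
  obtain ⟨h1, h2, h3, h4⟩ := ht
  obtain ⟨k1, k2, k3, k4⟩ := hu
  rw [clawResidual, clawResidual, orthResidual_orthResidual _ two_ne_zero h.gramForm_clawBasis _ _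
    fun _ => gramForm_comm _ _ _]
  simp [Fin.sum_univ_four, clawBasis, gramForm_of_ne H h1, gramForm_of_ne H h2,
    gramForm_of_ne H h3, gramForm_of_ne H h4, gramForm_of_ne H k1, gramForm_of_ne H k2,
    gramForm_of_ne H k3, gramForm_of_ne H k4]

lemma IsClaw.sum_compl {k : ℕ} (hk : H.IsRegularOfDegree k) {p q s r : V} (h : IsClaw H p q s r)
    (x : V) : ∑ t ∈ ({p, q, s, r} : Finset V)ᶜ, adjInd H t x =
      k - (adjInd H p x + adjInd H q x + adjInd H s x + adjInd H r x) := by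
  rw [← sum_adjInd H hk x, ← sum_add_sum_compl ({p, q, s, r} : Finset V),
    sum_insert (by simp [h.pq, h.ps, h.rp.ne.symm]), sum_insert (by simp [h.qs, h.rq.ne.symm]),
    sum_insert (by simp [h.rs.ne.symm]), sum_singleton]
  ring

lemma IsClaw.sum_leaf {k : ℕ} (hk : H.IsRegularOfDegree k) {p q s r : V} (h : IsClaw H p q s r) :
    ∑ t ∈ ({p, q, s, r} : Finset V)ᶜ, adjInd H t p = k - 1 := by
  rw [h.sum_compl hk]
  simp [adjInd, h.rp, mt H.adj_symm h.npq, mt H.adj_symm h.nps]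

lemma IsClaw.sum_center {k : ℕ} (hk : H.IsRegularOfDegree k) {p q s r : V}
    (h : IsClaw H p q s r) :
    ∑ t ∈ ({p, q, s, r} : Finset V)ᶜ, adjInd H t r = k - 3 := by
  rw [h.sum_compl hk]
  simp [adjInd, h.rp.symm, h.rq.symm, h.rs.symm]
  norm_num

/-- `P, Q, S, R` are the adjacencies of a vertex to the claw, and the hypothesis says that its
residual has positive norm. Of the sixteen patterns only the zero pattern and nine others survive;
the nine have unit residual and split into three classes, according to which leaf is treated
differently from the other two. -/
lemma claw_type {P Q S R : ℝ} (hP : P = 0 ∨ P = 1) (hQ : Q = 0 ∨ Q = 1) (hS : S = 0 ∨ S = 1)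
    (hR : R = 0 ∨ R = 1) (h : 0 < 2 - (P * P + Q * Q + S * S +
      (P + Q + S - 2 * R) * (P + Q + S - 2 * R)) / 2) :
    (P = 0 ∧ Q = 0 ∧ S = 0 ∧ R = 0) ∨
    (2 - (P * P + Q * Q + S * S + (P + Q + S - 2 * R) * (P + Q + S - 2 * R)) / 2 = 1 ∧
      P + Q + S - R ≤ 1 ∧
      ((P = Q ∧ S = 1 - P ∧ P ≤ R) ∨ (P = S ∧ Q = 1 - P ∧ P ≤ R) ∨
        (Q = S ∧ P = 1 - Q ∧ Q ≤ R))) := by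
  rcases hP with rfl | rfl <;> rcases hQ with rfl | rfl <;> rcases hS with rfl | rfl <;>
    rcases hR with rfl | rfl <;> revert h <;> norm_num

/-- The vertices outside of an induced claw that are adjacent to both or to none of the leaves
`p`, `q`, and behave differently with respect to `s`. -/
noncomputable def clawClass (H : SimpleGraph V) [DecidableRel H.Adj] (p q s r : V) : Finset V :=
  {t ∈ ({p, q, s, r} : Finset V)ᶜ | adjInd H t p = adjInd H t q ∧ adjInd H t p ≠ adjInd H t s}

lemma GramPos.gramForm_clawResidual_pos (hH : GramPos H) {p q s r t : V}
    (ht : t ∉ ({p, q, s, r} : Finset V)) :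
    0 < gramForm H (clawResidual H p q s r t) (clawResidual H p q s r t) :=
  hH.pos_of_apply_eq_one (v := t) (by rw [clawResidual_apply t ht, stdVec_self])

lemma IsClaw.type {p q s r : V} (h : IsClaw H p q s r) (hH : GramPos H) {t : V}
    (ht : t ∉ ({p, q, s, r} : Finset V)) :
    (adjInd H t p = 0 ∧ adjInd H t q = 0 ∧ adjInd H t s = 0 ∧ adjInd H t r = 0) ∨
    (gramForm H (clawResidual H p q s r t) (clawResidual H p q s r t) = 1 ∧
      adjInd H t p + adjInd H t q + adjInd H t s - adjInd H t r ≤ 1 ∧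
      ((adjInd H t p = adjInd H t q ∧ adjInd H t s = 1 - adjInd H t p ∧
          adjInd H t p ≤ adjInd H t r) ∨
        (adjInd H t p = adjInd H t s ∧ adjInd H t q = 1 - adjInd H t p ∧
          adjInd H t p ≤ adjInd H t r) ∨
        (adjInd H t q = adjInd H t s ∧ adjInd H t p = 1 - adjInd H t q ∧
          adjInd H t q ≤ adjInd H t r))) := by
  have h1 := hH.gramForm_clawResidual_pos ht
  rw [h.gramForm_clawResidual ht ht, gramForm_self] at h1 ⊢
  exact claw_type (adjInd_eq_zero_or_one H t p) (adjInd_eq_zero_or_one H t q)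
    (adjInd_eq_zero_or_one H t s) (adjInd_eq_zero_or_one H t r) h1

/-- The strict Cauchy–Schwarz inequality for two independent unit vectors, read off from their sum
and difference. -/
lemma GramPos.abs_gramForm_clawResidual_lt (hH : GramPos H) {p q s r t u : V}
    (htu : t ≠ u) (ht : t ∉ ({p, q, s, r} : Finset V))
    (ht1 : gramForm H (clawResidual H p q s r t) (clawResidual H p q s r t) = 1)
    (hu1 : gramForm H (clawResidual H p q s r u) (clawResidual H p q s r u) = 1) :
    |gramForm H (clawResidual H p q s r t) (clawResidual H p q s r u)| < 1 := by
  have h1 : 0 < gramForm H (clawResidual H p q s r t - clawResidual H p q s r u)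
      (clawResidual H p q s r t - clawResidual H p q s r u) :=
    hH.pos_of_apply_eq_one (v := t) (by
      rw [Pi.sub_apply, clawResidual_apply t ht, clawResidual_apply u ht, stdVec_self,
        stdVec_of_ne htu, sub_zero])
  have h2 : 0 < gramForm H (clawResidual H p q s r t + clawResidual H p q s r u)
      (clawResidual H p q s r t + clawResidual H p q s r u) :=
    hH.pos_of_apply_eq_one (v := t) (by
      rw [Pi.add_apply, clawResidual_apply t ht, clawResidual_apply u ht, stdVec_self,
        stdVec_of_ne htu, add_zero])
  simp only [map_add, map_sub, LinearMap.add_apply, LinearMap.sub_apply, ht1, hu1,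
    gramForm_comm H (clawResidual H p q s r u) (clawResidual H p q s r t)] at h1 h2
  rw [abs_lt]
  constructor <;> linarith

/-- Within one class the inner product of two residuals is an integer, so it vanishes once it is
smaller than `1` in absolute value. -/
lemma eq_zero_of_same_type {a P S R P' S' R' : ℝ} (ha : a = 0 ∨ a = 1) (hP : P = 0 ∨ P = 1)
    (hR : R = 0 ∨ R = 1) (hP' : P' = 0 ∨ P' = 1) (hR' : R' = 0 ∨ R' = 1)
    (hS : S = 1 - P) (hS' : S' = 1 - P') (hPR : P ≤ R) (hPR' : P' ≤ R')
    (h : |a - (P * P' + P * P' + S * S' + (P + P + S - 2 * R) * (P' + P' + S' - 2 * R')) / 2| < 1) :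
    a - (P * P' + P * P' + S * S' + (P + P + S - 2 * R) * (P' + P' + S' - 2 * R')) / 2 = 0 := by
  subst hS hS'
  rcases ha with rfl | rfl <;> rcases hP with rfl | rfl <;> rcases hR with rfl | rfl <;>
    rcases hP' with rfl | rfl <;> rcases hR' with rfl | rfl <;>
    revert h hPR hPR' <;> norm_num

/-- Between different classes the inner product is half an odd integer, hence `±1/2`. -/
lemma sq_eq_of_different_type {a P Q S R P' S' R' : ℝ} (ha : a = 0 ∨ a = 1) (hP : P = 0 ∨ P = 1)
    (hQ : Q = 0 ∨ Q = 1) (hR : R = 0 ∨ R = 1) (hS : S = 0 ∨ S = 1)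
    (hP' : P' = 0 ∨ P' = 1) (hR' : R' = 0 ∨ R' = 1)
    (hPQ : P ≠ Q) (hS' : S' = 1 - P') (hPR' : P' ≤ R')
    (h : |a - (P * P' + Q * P' + S * S' + (P + Q + S - 2 * R) * (P' + P' + S' - 2 * R')) / 2| < 1) :
    (a - (P * P' + Q * P' + S * S' + (P + Q + S - 2 * R) * (P' + P' + S' - 2 * R')) / 2) ^ 2 =
      1 / 4 := by
  subst hS'
  rcases hP with rfl | rfl <;> rcases hQ with rfl | rfl <;> try (exact absurd rfl hPQ)
  all_goals
    rcases ha with rfl | rfl <;> rcases hR with rfl | rfl <;> rcases hS with rfl | rfl <;>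
    rcases hP' with rfl | rfl <;> rcases hR' with rfl | rfl <;>
    revert h hPR' <;> norm_num [abs_lt]

lemma mem_clawClass {p q s r t : V} : t ∈ clawClass H p q s r ↔
    t ∉ ({p, q, s, r} : Finset V) ∧ adjInd H t p = adjInd H t q ∧
      adjInd H t p ≠ adjInd H t s := by
  simp [clawClass, and_assoc]

lemma IsClaw.type_of_mem_clawClass {p q s r : V} (h : IsClaw H p q s r) (hH : GramPos H) {t : V}
    (ht : t ∈ clawClass H p q s r) :
    gramForm H (clawResidual H p q s r t) (clawResidual H p q s r t) = 1 ∧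
      adjInd H t s = 1 - adjInd H t p ∧ adjInd H t p ≤ adjInd H t r := by
  obtain ⟨h1, h2, h3⟩ := mem_clawClass.1 ht
  rcases h.type hH h1 with ⟨e1, e2, e3, e4⟩ | ⟨e1, -, e2 | e2 | e2⟩
  · exact absurd (e1.trans e3.symm) h3
  · exact ⟨e1, e2.2⟩
  · exact absurd e2.1 h3
  · exact absurd (h2.trans e2.1) h3

/-- Four residuals in one class would be orthonormal, and a unit residual from another class would
have inner product `±1/2` with each. Projecting it off them leaves norm `1 - 4 · (1/4) = 0`. So the
other two classes would be empty, which a count of edges at the claw forbids. -/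
lemma IsClaw.card_clawClass_le {k : ℕ} (hk : H.IsRegularOfDegree k) (hH : GramPos H)
    {p q s r : V} (h : IsClaw H p q s r) : #(clawClass H p q s r) ≤ 3 := by
  by_contra! hcard
  obtain ⟨T, hT, hT4⟩ := exists_subset_card_eq hcard
  have hTtype := fun (t : V) (ht : t ∈ T) => h.type_of_mem_clawClass hH (hT ht)
  have hTout : ∀ t ∈ T, t ∉ ({p, q, s, r} : Finset V) := fun t ht => (mem_clawClass.1 (hT ht)).1
  have hTeq : ∀ t ∈ T, adjInd H t q = adjInd H t p :=
    fun t ht => (mem_clawClass.1 (hT ht)).2.1.symm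
  have hsame : ∀ t, t ∉ ({p, q, s, r} : Finset V) → adjInd H t p = adjInd H t q := by
    intro u hu
    by_contra hne
    have hu1 : gramForm H (clawResidual H p q s r u) (clawResidual H p q s r u) = 1 := by
      rcases h.type hH hu with ⟨e1, e2, -⟩ | ⟨e1, -⟩
      · exact absurd (e1.trans e2.symm) hne
      · exact e1
    have huT : ∀ t ∈ T, u ≠ t := by
      rintro t ht rfl
      exact hne (hTeq u ht).symm
    have horth : ∀ i j : T, gramForm H (clawResidual H p q s r i) (clawResidual H p q s r j) =
        if i = j then 1 else 0 := by
      intro i j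
      split_ifs with hij
      · rw [hij]
        exact (hTtype j j.2).1
      · have hij' : (i : V) ≠ j := fun h' => hij (Subtype.ext h')
        have h1 := hH.abs_gramForm_clawResidual_lt hij' (hTout i i.2) (hTtype i i.2).1
          (hTtype j j.2).1
        rw [h.gramForm_clawResidual (hTout i i.2) (hTout j j.2), gramForm_of_ne H hij',
          hTeq i i.2, hTeq j j.2] at h1 ⊢
        exact eq_zero_of_same_type (adjInd_eq_zero_or_one H _ _) (adjInd_eq_zero_or_one H _ _)
          (adjInd_eq_zero_or_one H _ _) (adjInd_eq_zero_or_one H _ _)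
          (adjInd_eq_zero_or_one H _ _) (hTtype i i.2).2.1 (hTtype j j.2).2.1 (hTtype i i.2).2.2
          (hTtype j j.2).2.2 h1
    have hcross : ∀ i : T, gramForm H (clawResidual H p q s r u) (clawResidual H p q s r i) *
        gramForm H (clawResidual H p q s r u) (clawResidual H p q s r i) = 1 / 4 := by
      intro i
      have h1 := hH.abs_gramForm_clawResidual_lt (huT i i.2) hu hu1 (hTtype i i.2).1
      rw [h.gramForm_clawResidual hu (hTout i i.2), gramForm_of_ne H (huT i i.2),
        hTeq i i.2] at h1 ⊢
      rw [← sq]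
      exact sq_eq_of_different_type (adjInd_eq_zero_or_one H _ _) (adjInd_eq_zero_or_one H _ _)
        (adjInd_eq_zero_or_one H _ _) (adjInd_eq_zero_or_one H _ _) (adjInd_eq_zero_or_one H _ _)
        (adjInd_eq_zero_or_one H _ _) (adjInd_eq_zero_or_one H _ _) hne (hTtype i i.2).2.1
        (hTtype i i.2).2.2 h1
    have hpos : 0 < gramForm H
        (orthResidual (gramForm H) (fun i : T => clawResidual H p q s r i) 1
          (clawResidual H p q s r u))
        (orthResidual (gramForm H) (fun i : T => clawResidual H p q s r i) 1
          (clawResidual H p q s r u)) := by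
      refine hH.pos_of_apply_eq_one (v := u) ?_
      rw [orthResidual, Pi.sub_apply, clawResidual_apply u hu, stdVec_self, Finset.sum_apply,
        sum_eq_zero, sub_zero]
      intro i _
      rw [Pi.smul_apply, clawResidual_apply _ hu, stdVec_of_ne (huT i i.2), smul_zero]
    rw [orthResidual_orthResidual _ one_ne_zero horth _ _ fun i => gramForm_comm H _ _, hu1,
      sum_congr rfl fun i _ => hcross i] at hpos
    simp [hT4] at hpos
  -- If all outer vertices treat `p` and `q` alike, then those adjacent to both are adjacent to `r`.
  -- Summing gives `2(k - 1) ≤ 2(k - 3)`.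
  have hle : ∑ t ∈ ({p, q, s, r} : Finset V)ᶜ, (adjInd H t p + adjInd H t q) ≤
      ∑ t ∈ ({p, q, s, r} : Finset V)ᶜ, 2 * adjInd H t r := by
    refine sum_le_sum fun t ht => ?_
    rw [mem_compl] at ht
    have h1 := hsame t ht
    rcases h.type hH ht with ⟨e1, e2, e3, e4⟩ | ⟨-, -, e | e | e⟩
    · rw [e1, e2, e4]; norm_num
    · rw [← h1]; linarith [e.2.2]
    · rw [← h1]; linarith [e.2.2]
    · rw [h1]; linarith [e.2.2]
  rw [sum_add_distrib, ← mul_sum, h.sum_leaf hk, h.sum_center hk] at hle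
  have h2 := h.swap_left.sum_leaf hk
  have h3 : ({q, p, s, r} : Finset V) = {p, q, s, r} := by
    ext; simp only [mem_insert, mem_singleton]; tauto
  rw [h3] at h2
  rw [h2] at hle
  linarith

/-- A regular graph of degree at least five with least eigenvalue larger than `-2` contains no
induced claw. -/
theorem GramPos.not_isClaw {k : ℕ} (hk : H.IsRegularOfDegree k) (hk5 : 5 ≤ k) (hH : GramPos H)
    {p q s r : V} : ¬ IsClaw H p q s r := by
  intro h
  have h3 : ({p, s, q, r} : Finset V) = {p, q, s, r} := by
    ext; simp only [mem_insert, mem_singleton]; tauto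
  have h4 : ({q, s, p, r} : Finset V) = {p, q, s, r} := by
    ext; simp only [mem_insert, mem_singleton]; tauto
  have h5 : ({q, p, s, r} : Finset V) = {p, q, s, r} := by
    ext; simp only [mem_insert, mem_singleton]; tauto
  have h6 : ({s, p, q, r} : Finset V) = {p, q, s, r} := by
    ext; simp only [mem_insert, mem_singleton]; tauto
  set U := clawClass H p q s r ∪ clawClass H p s q r ∪ clawClass H q s p r with hU
  have hUcard : #U ≤ 9 := by
    rw [hU]
    have c1 := h.card_clawClass_le hk hH
    have c2 := h.swap_right.card_clawClass_le hk hH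
    have c3 := h.swap_left.swap_right.card_clawClass_le hk hH
    have := card_union_le (clawClass H p q s r ∪ clawClass H p s q r) (clawClass H q s p r)
    have := card_union_le (clawClass H p q s r) (clawClass H p s q r)
    omega
  have hUsub : U ⊆ ({p, q, s, r} : Finset V)ᶜ := by
    intro t ht
    simp only [hU, mem_union, mem_clawClass, h3, h4] at ht
    rw [mem_compl]
    tauto
  -- The left-hand side sums to `3(k - 1) - (k - 3) = 2k`, while at most nine terms are positive,
  -- each at most `1`. This fails for `k ≥ 5`.
  have hle : ∑ t ∈ ({p, q, s, r} : Finset V)ᶜ,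
      (adjInd H t p + adjInd H t q + adjInd H t s - adjInd H t r) ≤
      ∑ t ∈ ({p, q, s, r} : Finset V)ᶜ, if t ∈ U then (1 : ℝ) else 0 := by
    refine sum_le_sum fun t ht => ?_
    rw [mem_compl] at ht
    have hne : (1 / 2 : ℝ) ≠ adjInd H t p ∧ (1 / 2 : ℝ) ≠ adjInd H t q := by
      constructor
      · rcases adjInd_eq_zero_or_one H t p with e | e <;> rw [e] <;> norm_num
      · rcases adjInd_eq_zero_or_one H t q with e | e <;> rw [e] <;> norm_num
    rcases h.type hH ht with ⟨e1, e2, e3, e4⟩ | ⟨-, e1, e2⟩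
    · rw [e1, e2, e3, e4]; split_ifs <;> norm_num
    · rw [if_pos]
      · exact e1
      · simp only [hU, mem_union, mem_clawClass, h3, h4]
        rcases e2 with e | e | e
        · exact Or.inl (Or.inl ⟨ht, e.1, fun h' => hne.1 (by linarith [e.2.1])⟩)
        · exact Or.inl (Or.inr ⟨ht, e.1, fun h' => hne.1 (by linarith [e.2.1])⟩)
        · exact Or.inr ⟨ht, e.1, fun h' => hne.2 (by linarith [e.2.1])⟩
  rw [sum_sub_distrib, sum_add_distrib, sum_add_distrib, h.sum_leaf hk, h.sum_center hk,
    sum_ite_mem, inter_eq_right.2 hUsub, sum_const, nsmul_eq_mul, mul_one] at hle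
  have s1 := h.swap_left.sum_leaf hk
  have s2 := h.swap_right.swap_left.sum_leaf hk
  rw [h5] at s1
  rw [h6] at s2
  rw [s1, s2] at hle
  have h7 : (#U : ℝ) ≤ 9 := by exact_mod_cast hUcard
  have h8 : (5 : ℝ) ≤ k := by exact_mod_cast hk5
  linarith

end Claw

/-! ### Nonadjacent vertices with a triangle of common neighbours. -/

section TripleCommonNeighbors

variable {V : Type*} [Fintype V] [DecidableEq V] {H : SimpleGraph V} [DecidableRel H.Adj]

/-- The distinct nonadjacent vertices `p`, `q` have the triangle `a`, `b`, `c` as common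
neighbours. -/
structure IsTripleBridge (H : SimpleGraph V) (p q a b c : V) : Prop where
  pq : p ≠ q
  npq : ¬ H.Adj p q
  ab : H.Adj a b
  ac : H.Adj a c
  bc : H.Adj b c
  ap : H.Adj a p
  aq : H.Adj a q
  bp : H.Adj b p
  bq : H.Adj b q
  cp : H.Adj c p
  cq : H.Adj c q

/-- Five pairwise orthogonal vectors in the span of a triple bridge. -/
def bridgeBasis (p q a b c : V) : Fin 5 → V → ℝ :=
  ![stdVec p + stdVec q, stdVec p - stdVec q, (2 : ℝ) • stdVec a - stdVec p - stdVec q,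
    (2 : ℝ) • stdVec b - stdVec p - stdVec q, (2 : ℝ) • stdVec c - stdVec p - stdVec q]

lemma IsTripleBridge.gramForm_bridgeBasis {p q a b c : V} (h : IsTripleBridge H p q a b c)
    (i j : Fin 5) :
    gramForm H (bridgeBasis p q a b c i) (bridgeBasis p q a b c j) = if i = j then 4 else 0 := by
  have e1 := gramForm_of_not_adj H h.pq h.npq
  have e2 := gramForm_of_not_adj H h.pq.symm (mt H.adj_symm h.npq)
  have a1 := gramForm_of_adj H h.ab
  have a2 := gramForm_of_adj H h.ac
  have a3 := gramForm_of_adj H h.bc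
  have a4 := gramForm_of_adj H h.ap
  have a5 := gramForm_of_adj H h.aq
  have a6 := gramForm_of_adj H h.bp
  have a7 := gramForm_of_adj H h.bq
  have a8 := gramForm_of_adj H h.cp
  have a9 := gramForm_of_adj H h.cq
  have b1 := gramForm_of_adj H h.ab.symm
  have b2 := gramForm_of_adj H h.ac.symm
  have b3 := gramForm_of_adj H h.bc.symm
  have b4 := gramForm_of_adj H h.ap.symm
  have b5 := gramForm_of_adj H h.aq.symm
  have b6 := gramForm_of_adj H h.bp.symm
  have b7 := gramForm_of_adj H h.bq.symm
  have b8 := gramForm_of_adj H h.cp.symm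
  have b9 := gramForm_of_adj H h.cq.symm
  fin_cases i <;> fin_cases j <;>
    simp only [bridgeBasis, Fin.zero_eta, Fin.mk_one, Fin.reduceFinMk, Matrix.cons_val, map_add,
      map_sub, map_smul, LinearMap.add_apply, LinearMap.sub_apply, LinearMap.smul_apply,
      gramForm_self, smul_eq_mul, e1, e2, a1, a2, a3, a4, a5, a6, a7, a8, a9, b1, b2, b3, b4, b5,
      b6, b7, b8, b9] <;>
    simp <;> norm_num

omit [Fintype V] in
lemma bridgeBasis_apply {p q a b c t : V} (ht : t ∉ ({p, q, a, b, c} : Finset V)) (i : Fin 5) :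
    bridgeBasis p q a b c i t = 0 := by
  simp only [mem_insert, mem_singleton, not_or] at ht
  obtain ⟨h1, h2, h3, h4, h5⟩ := ht
  fin_cases i <;>
    simp [bridgeBasis, stdVec_of_ne h1, stdVec_of_ne h2, stdVec_of_ne h3, stdVec_of_ne h4,
      stdVec_of_ne h5]

/-- The component of a basis vector orthogonal to a triple bridge. -/
noncomputable def bridgeResidual (H : SimpleGraph V) [DecidableRel H.Adj] (p q a b c t : V) :
    V → ℝ :=
  orthResidual (gramForm H) (bridgeBasis p q a b c) 4 (stdVec t)

lemma bridgeResidual_apply {p q a b c t : V} (u : V) (ht : t ∉ ({p, q, a, b, c} : Finset V)) :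
    bridgeResidual H p q a b c u t = stdVec u t := by
  simp [bridgeResidual, orthResidual, Finset.sum_apply, bridgeBasis_apply ht]

/-- The vertices adjacent to exactly one of `p`, `q`. -/
noncomputable def bridgeDiff (H : SimpleGraph V) [DecidableRel H.Adj] (p q : V) : Finset V :=
  {t | t ≠ p ∧ t ≠ q ∧ adjInd H t q = 1 - adjInd H t p}

lemma IsTripleBridge.not_mem_of_mem_bridgeDiff {p q a b c t : V} (h : IsTripleBridge H p q a b c)
    (ht : t ∈ bridgeDiff H p q) : t ∉ ({p, q, a, b, c} : Finset V) := by
  simp only [bridgeDiff, mem_filter_univ] at ht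
  obtain ⟨h1, h2, h3⟩ := ht
  simp only [mem_insert, mem_singleton, not_or]
  refine ⟨h1, h2, ?_, ?_, ?_⟩ <;> rintro rfl
  · simp [adjInd, h.ap, h.aq] at h3
  · simp [adjInd, h.bp, h.bq] at h3
  · simp [adjInd, h.cp, h.cq] at h3

/-- The adjacency of `t` to `u`, encoded as a sign. -/
noncomputable def adjSign (H : SimpleGraph V) [DecidableRel H.Adj] (t u : V) : ℝ :=
  2 * adjInd H t u - 1

omit [Fintype V] [DecidableEq V] in
lemma adjSign_eq (t u : V) : adjSign H t u = 1 ∨ adjSign H t u = -1 := by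
  unfold adjSign
  rcases adjInd_eq_zero_or_one H t u with h | h <;> rw [h] <;> norm_num

/-- A vertex adjacent to exactly one of `p`, `q` has inner product `1` with the first basis vector
and `±1` with the other four. -/
lemma IsTripleBridge.gramForm_bridgeResidual {p q a b c t u : V}
    (h : IsTripleBridge H p q a b c) (ht : t ∈ bridgeDiff H p q) (hu : u ∈ bridgeDiff H p q) :
    gramForm H (bridgeResidual H p q a b c t) (bridgeResidual H p q a b c u) =
      gramForm H (stdVec t) (stdVec u) -
      (1 + adjSign H t p * adjSign H u p + adjSign H t a * adjSign H u a +
        adjSign H t b * adjSign H u b + adjSign H t c * adjSign H u c) / 4 := by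
  have ht' := h.not_mem_of_mem_bridgeDiff ht
  have hu' := h.not_mem_of_mem_bridgeDiff hu
  simp only [mem_insert, mem_singleton, not_or] at ht' hu'
  simp only [bridgeDiff, mem_filter_univ] at ht hu
  obtain ⟨h1, h2, h3, h4, h5⟩ := ht'
  obtain ⟨k1, k2, k3, k4, k5⟩ := hu'
  rw [bridgeResidual, bridgeResidual, orthResidual_orthResidual _ four_ne_zero
    h.gramForm_bridgeBasis _ _ fun _ => gramForm_comm _ _ _]
  simp only [Fin.sum_univ_five, bridgeBasis, Matrix.cons_val, map_add, map_sub, map_smul,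
    smul_eq_mul,
    gramForm_of_ne H h1, gramForm_of_ne H h2, gramForm_of_ne H h3, gramForm_of_ne H h4,
    gramForm_of_ne H h5, gramForm_of_ne H k1, gramForm_of_ne H k2, gramForm_of_ne H k3,
    gramForm_of_ne H k4, gramForm_of_ne H k5, ht.2.2, hu.2.2, adjSign]
  ring

lemma mul_eq_of_signs {x y : ℝ} (hx : x = 1 ∨ x = -1) (hy : y = 1 ∨ y = -1) :
    x * y = 1 ∨ x * y = -1 := by
  rcases hx with rfl | rfl <;> rcases hy with rfl | rfl <;> norm_num

/-- Four times the inner product is an odd integer whose residue modulo `4` is fixed by the parity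
of the number of minus signs. Being smaller than `3` in absolute value, it is `±1`, with sign
determined by the product of the four signs. -/
lemma eq_of_signs {x y z w e : ℝ} (hx : x = 1 ∨ x = -1) (hy : y = 1 ∨ y = -1)
    (hz : z = 1 ∨ z = -1) (hw : w = 1 ∨ w = -1) (he : e = 0 ∨ e = 1)
    (h : |e - (1 + x + y + z + w) / 4| < 3 / 4) :
    x * y * z * w * (e - (1 + x + y + z + w) / 4) = -(1 / 4) := by
  rcases hx with rfl | rfl <;> rcases hy with rfl | rfl <;> rcases hz with rfl | rfl <;>
    rcases hw with rfl | rfl <;> rcases he with rfl | rfl <;> revert h <;> norm_num [abs_lt]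

/-- Residuals here have norm `3/4`, and after suitable sign changes all mutual inner products are
`-1/4`. Four of them would sum to a nonzero vector of norm `0`. -/
theorem IsTripleBridge.card_bridgeDiff_le (hH : GramPos H) {p q a b c : V}
    (h : IsTripleBridge H p q a b c) : #(bridgeDiff H p q) ≤ 3 := by
  by_contra! hcard
  obtain ⟨T, hT, hT4⟩ := exists_subset_card_eq hcard
  set y := bridgeResidual H p q a b c with hy
  have hout : ∀ t ∈ T, t ∉ ({p, q, a, b, c} : Finset V) :=
    fun t ht => h.not_mem_of_mem_bridgeDiff (hT ht)
  have hself : ∀ t ∈ T, gramForm H (y t) (y t) = 3 / 4 := by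
    intro t ht
    rw [hy, h.gramForm_bridgeResidual (hT ht) (hT ht), gramForm_self]
    rcases adjSign_eq (H := H) t p with e1 | e1 <;> rcases adjSign_eq (H := H) t a with e2 | e2 <;>
      rcases adjSign_eq (H := H) t b with e3 | e3 <;>
      rcases adjSign_eq (H := H) t c with e4 | e4 <;> rw [e1, e2, e3, e4] <;> norm_num
  set ε : V → ℝ := fun t => adjSign H t p * adjSign H t a * adjSign H t b * adjSign H t c with hε
  have hεsign : ∀ t, ε t = 1 ∨ ε t = -1 := fun t =>
    mul_eq_of_signs (mul_eq_of_signs (mul_eq_of_signs (adjSign_eq t p) (adjSign_eq t a))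
      (adjSign_eq t b)) (adjSign_eq t c)
  have hpair : ∀ t ∈ T, ∀ u ∈ T, t ≠ u → ε t * ε u * gramForm H (y t) (y u) = -(1 / 4) := by
    intro t ht u hu htu
    have h1 : 0 < gramForm H (y t - y u) (y t - y u) := hH.pos_of_apply_eq_one (v := t) (by
      rw [Pi.sub_apply, hy, bridgeResidual_apply t (hout t ht), bridgeResidual_apply u (hout t ht),
        stdVec_self, stdVec_of_ne htu, sub_zero])
    have h2 : 0 < gramForm H (y t + y u) (y t + y u) := hH.pos_of_apply_eq_one (v := t) (by
      rw [Pi.add_apply, hy, bridgeResidual_apply t (hout t ht), bridgeResidual_apply u (hout t ht),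
        stdVec_self, stdVec_of_ne htu, add_zero])
    simp only [map_add, map_sub, LinearMap.add_apply, LinearMap.sub_apply, hself t ht, hself u hu,
      gramForm_comm H (y u) (y t)] at h1 h2
    have h3 : |gramForm H (y t) (y u)| < 3 / 4 := by
      rw [abs_lt]
      constructor <;> linarith
    rw [hy, h.gramForm_bridgeResidual (hT ht) (hT hu), gramForm_of_ne H htu] at h3 ⊢
    have h4 := eq_of_signs (mul_eq_of_signs (adjSign_eq t p) (adjSign_eq u p))
      (mul_eq_of_signs (adjSign_eq t a) (adjSign_eq u a))
      (mul_eq_of_signs (adjSign_eq t b) (adjSign_eq u b))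
      (mul_eq_of_signs (adjSign_eq t c) (adjSign_eq u c)) (adjInd_eq_zero_or_one H t u) h3
    rw [← h4]
    simp only [hε]
    ring
  obtain ⟨t₀, ht₀⟩ : T.Nonempty := card_pos.1 (by omega)
  have hne : (∑ t ∈ T, ε t • y t) ≠ 0 := by
    intro h0
    have h1 := congrFun h0 t₀
    rw [Finset.sum_apply, sum_eq_single_of_mem t₀ ht₀, Pi.smul_apply, hy,
      bridgeResidual_apply t₀ (hout t₀ ht₀), stdVec_self] at h1
    · rcases hεsign t₀ with e | e <;> rw [e] at h1 <;> norm_num at h1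
    · intro u hu hut
      rw [Pi.smul_apply, hy, bridgeResidual_apply u (hout t₀ ht₀), stdVec_of_ne hut.symm,
        smul_zero]
  have hpos := hH _ hne
  have hsum : gramForm H (∑ t ∈ T, ε t • y t) (∑ t ∈ T, ε t • y t) =
      ∑ t ∈ T, ∑ u ∈ T, ε t * ε u * gramForm H (y t) (y u) := by
    simp only [map_sum, LinearMap.sum_apply, map_smul, LinearMap.smul_apply, smul_eq_mul, mul_sum]
    rw [sum_comm]
    refine sum_congr rfl fun t _ => sum_congr rfl fun u _ => ?_
    ring
  have hrow : ∀ t ∈ T, ∑ u ∈ T, ε t * ε u * gramForm H (y t) (y u) = 0 := by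
    intro t ht
    rw [← add_sum_erase T _ ht, hself t ht, sum_congr rfl (g := fun _ => -(1 / 4 : ℝ)) fun u hu =>
      hpair t ht u (mem_of_mem_erase hu) (ne_of_mem_erase hu).symm, sum_const,
      card_erase_of_mem ht, hT4]
    rcases hεsign t with e | e <;> rw [e] <;> norm_num
  rw [hsum, sum_eq_zero hrow] at hpos
  exact lt_irrefl _ hpos

end TripleCommonNeighbors

/-! ### The collinearity graph of a regular graph with large gap. -/

section Collinearity

variable {V : Type*}

/-- Two vertices are adjacent in the collinearity graph of `G` if they have a common neighbour. -/
def collinearityGraph (G : SimpleGraph V) : SimpleGraph V where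
  Adj u v := u ≠ v ∧ ∃ w, G.Adj u w ∧ G.Adj v w
  symm := ⟨fun _ _ h => ⟨h.1.symm, h.2.imp fun _ h' => h'.symm⟩⟩
  loopless := ⟨fun _ h => h.1 rfl⟩

noncomputable instance (G : SimpleGraph V) : DecidableRel (collinearityGraph G).Adj :=
  Classical.decRel _

/-- Distinct vertices have at most one common neighbour. -/
def IsLinearSpace (G : SimpleGraph V) : Prop :=
  ∀ ⦃u v w w' : V⦄, u ≠ v → G.Adj u w → G.Adj v w → G.Adj u w' → G.Adj v w' → w = w'

variable [Fintype V] [DecidableEq V] {G : SimpleGraph V} [DecidableRel G.Adj] {d : ℕ}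

lemma sum_sq_sum_neighborFinset (f : V → ℝ) :
    ∑ w, (∑ v ∈ G.neighborFinset w, f v) ^ 2 =
      ∑ u, ∑ v, f u * f v * #(G.neighborFinset u ∩ G.neighborFinset v) := by
  have h3 : ∀ w, (∑ v ∈ G.neighborFinset w, f v) ^ 2 =
      ∑ u, ∑ v, f u * f v * (if w ∈ G.neighborFinset u ∩ G.neighborFinset v then 1 else 0) := by
    intro w
    rw [sq, ← univ_inter (G.neighborFinset w), ← sum_ite_mem, sum_mul_sum]
    refine sum_congr rfl fun u _ => sum_congr rfl fun v _ => ?_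
    simp only [mem_inter, SimpleGraph.mem_neighborFinset, G.adj_comm u, G.adj_comm v]
    by_cases a : G.Adj w u <;> by_cases b : G.Adj w v <;> simp [a, b]
  rw [sum_congr rfl fun w _ => h3 w, sum_comm]
  refine sum_congr rfl fun u _ => ?_
  rw [sum_comm]
  refine sum_congr rfl fun v _ => ?_
  rw [← mul_sum, sum_ite_mem, univ_inter, sum_const, nsmul_eq_mul, mul_one]

/-- For the difference of the basis vectors at `u` and `v` the hypothesis reads `2(d - 2) < 2d -
2c`, with `c` the number of common neighbours. -/
lemma card_inter_neighborFinset_le_one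
    (hexp : ∀ f : V → ℝ, f ≠ 0 →
      ((d : ℝ) - 2) * ∑ v, f v ^ 2 < ∑ w, (∑ v ∈ G.neighborFinset w, f v) ^ 2)
    (hd : ∀ v, G.degree v = d) {u v : V} (huv : u ≠ v) :
    #(G.neighborFinset u ∩ G.neighborFinset v) ≤ 1 := by
  have hne : (stdVec u - stdVec v : V → ℝ) ≠ 0 := by
    intro h
    have := congrFun h u
    simp [stdVec_self, stdVec_of_ne huv] at this
  have h1 := hexp _ hne
  have h2 : ∑ x, (stdVec u - stdVec v : V → ℝ) x ^ 2 = 2 := by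
    have h3 : ∀ x, (stdVec u - stdVec v : V → ℝ) x ^ 2 =
        (Pi.single u (1 : ℝ) : V → ℝ) x + (Pi.single v (1 : ℝ) : V → ℝ) x := by
      intro x
      simp only [Pi.sub_apply, stdVec]
      rcases eq_or_ne x u with rfl | hxu
      · simp [huv]
      · rcases eq_or_ne x v with rfl | hxv
        · simp [hxu]
        · simp [hxu, hxv]
    rw [sum_congr rfl fun x _ => h3 x, sum_add_distrib, sum_pi_single', sum_pi_single']
    norm_num
  have h4 : ∀ w, (∑ x ∈ G.neighborFinset w, (stdVec u - stdVec v : V → ℝ) x) ^ 2 =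
      (if w ∈ G.neighborFinset u then 1 else 0) + (if w ∈ G.neighborFinset v then 1 else 0) -
        2 * (if w ∈ G.neighborFinset u ∩ G.neighborFinset v then 1 else 0) := by
    intro w
    simp only [Pi.sub_apply, sum_sub_distrib, stdVec, sum_pi_single', mem_inter,
      SimpleGraph.mem_neighborFinset, G.adj_comm u, G.adj_comm v]
    by_cases a : G.Adj w u <;> by_cases b : G.Adj w v <;> simp [a, b]
    norm_num
  rw [h2, sum_congr rfl fun w _ => h4 w, sum_sub_distrib, sum_add_distrib, ← mul_sum, sum_ite_mem,
    sum_ite_mem, sum_ite_mem, univ_inter, univ_inter, univ_inter, sum_const, sum_const, sum_const,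
    SimpleGraph.card_neighborFinset_eq_degree, SimpleGraph.card_neighborFinset_eq_degree, hd,
    hd, nsmul_eq_mul, nsmul_eq_mul] at h1
  have h5 : (#(G.neighborFinset u ∩ G.neighborFinset v) : ℝ) < 2 := by linarith
  have h6 : #(G.neighborFinset u ∩ G.neighborFinset v) < 2 := by exact_mod_cast h5
  omega

lemma isLinearSpace_of_expansion
    (hexp : ∀ f : V → ℝ, f ≠ 0 →
      ((d : ℝ) - 2) * ∑ v, f v ^ 2 < ∑ w, (∑ v ∈ G.neighborFinset w, f v) ^ 2)
    (hd : ∀ v, G.degree v = d) : IsLinearSpace G := by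
  intro u v w w' huv h1 h2 h3 h4
  exact card_le_one.1 (card_inter_neighborFinset_le_one hexp hd huv) w (by simp [h1, h2]) w'
    (by simp [h3, h4])

lemma IsLinearSpace.card_inter (hG : IsLinearSpace G) {u v : V} (huv : u ≠ v) :
    (#(G.neighborFinset u ∩ G.neighborFinset v) : ℝ) = adjInd (collinearityGraph G) u v := by
  unfold adjInd
  split_ifs with h
  · obtain ⟨-, w, h1, h2⟩ := h
    have : G.neighborFinset u ∩ G.neighborFinset v = {w} := by
      ext x
      simp only [mem_inter, SimpleGraph.mem_neighborFinset, mem_singleton]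
      exact ⟨fun h => hG huv h.1 h.2 h1 h2, by rintro rfl; exact ⟨h1, h2⟩⟩
    rw [this, card_singleton, Nat.cast_one]
  · rw [Nat.cast_eq_zero, card_eq_zero, eq_empty_iff_forall_notMem]
    intro x hx
    simp only [mem_inter, SimpleGraph.mem_neighborFinset] at hx
    exact h ⟨huv, x, hx⟩

/-- With at most one common neighbour per pair, the square of the adjacency matrix is `d` plus the
adjacency matrix of the collinearity graph; subtracting `d - 2` leaves the Gram matrix. -/
lemma gramPos_collinearityGraph
    (hexp : ∀ f : V → ℝ, f ≠ 0 →
      ((d : ℝ) - 2) * ∑ v, f v ^ 2 < ∑ w, (∑ v ∈ G.neighborFinset w, f v) ^ 2)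
    (hd : ∀ v, G.degree v = d) : GramPos (collinearityGraph G) := by
  have hG := isLinearSpace_of_expansion hexp hd
  intro f hf
  have h1 := hexp f hf
  have h2 := sum_sq_sum_neighborFinset (G := G) f
  have h4 : gramForm (collinearityGraph G) f f =
      ∑ u, ∑ v, f u * f v * #(G.neighborFinset u ∩ G.neighborFinset v) -
        (d - 2) * ∑ v, f v ^ 2 := by
    rw [gramForm, Matrix.toBilin'_apply, mul_sum, ← sum_sub_distrib]
    refine sum_congr rfl fun u _ => ?_
    have h5 : ((d : ℝ) - 2) * f u ^ 2 = ∑ v, if u = v then ((d : ℝ) - 2) * f u ^ 2 else 0 := by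
      simp
    rw [h5, ← sum_sub_distrib]
    refine sum_congr rfl fun v _ => ?_
    split_ifs with huv
    · subst huv
      rw [inter_self, SimpleGraph.card_neighborFinset_eq_degree, hd, Matrix.add_apply,
        Matrix.smul_apply, Matrix.one_apply_eq]
      simp
      ring
    · rw [hG.card_inter huv, Matrix.add_apply, Matrix.smul_apply, Matrix.one_apply_ne huv]
      simp [SimpleGraph.adjMatrix_apply, adjInd]
  rw [h4]
  linarith

/-- Each of the `d` lines through `v` has `d - 1` further points, and no point is counted twice. -/
lemma IsLinearSpace.isRegularOfDegree (hG : IsLinearSpace G) (hd : ∀ v, G.degree v = d) :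
    (collinearityGraph G).IsRegularOfDegree (d * (d - 1)) := by
  intro v
  have h1 : (collinearityGraph G).neighborFinset v =
      (G.neighborFinset v).biUnion fun w => (G.neighborFinset w).erase v := by
    ext x
    simp only [SimpleGraph.mem_neighborFinset, mem_biUnion, mem_erase]
    constructor
    · rintro ⟨h1, w, h2, h3⟩
      exact ⟨w, h2, h1.symm, h3.symm⟩
    · rintro ⟨w, h2, h1, h3⟩
      exact ⟨Ne.symm h1, w, h2, h3.symm⟩
  rw [← SimpleGraph.card_neighborFinset_eq_degree, h1, card_biUnion]
  · rw [sum_congr rfl (g := fun _ => d - 1), sum_const,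
      SimpleGraph.card_neighborFinset_eq_degree, hd, smul_eq_mul]
    intro w hw
    rw [SimpleGraph.mem_neighborFinset] at hw
    rw [card_erase_of_mem (by simpa using hw.symm), SimpleGraph.card_neighborFinset_eq_degree, hd]
  · intro w hw w' hw' hne
    rw [mem_coe, SimpleGraph.mem_neighborFinset] at hw hw'
    rw [Function.onFun, disjoint_left]
    intro x hx hx'
    simp only [mem_erase, SimpleGraph.mem_neighborFinset] at hx hx'
    exact hne (hG hx.1 hx.2.symm hw hx'.2.symm hw')

/-- Distinct noncollinear vertices have at most two common neighbours in the collinearity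
graph. -/
theorem false_of_three_common (hd : ∀ v, G.degree v = d) (hd3 : 3 ≤ d) (hG : IsLinearSpace G)
    (hH : GramPos (collinearityGraph G)) {p q a b c : V} (hpq : p ≠ q)
    (hpq' : ¬ (collinearityGraph G).Adj p q) (hab : a ≠ b) (hac : a ≠ c) (hbc : b ≠ c)
    (hap : (collinearityGraph G).Adj a p) (haq : (collinearityGraph G).Adj a q)
    (hbp : (collinearityGraph G).Adj b p) (hbq : (collinearityGraph G).Adj b q)
    (hcp : (collinearityGraph G).Adj c p) (hcq : (collinearityGraph G).Adj c q) : False := by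
  have hk : (collinearityGraph G).IsRegularOfDegree (d * (d - 1)) := hG.isRegularOfDegree hd
  have hbridge : IsTripleBridge (collinearityGraph G) p q a b c :=
    ⟨hpq, hpq', hH.adj_of_square hpq hpq' hab hap haq hbp hbq,
      hH.adj_of_square hpq hpq' hac hap haq hcp hcq,
      hH.adj_of_square hpq hpq' hbc hbp hbq hcp hcq, hap, haq, hbp, hbq, hcp, hcq⟩
  have h1 := hbridge.card_bridgeDiff_le hH
  set P := (collinearityGraph G).neighborFinset p with hP
  set Q := (collinearityGraph G).neighborFinset q with hQ
  have hPcard : #P = d * (d - 1) := hk p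
  have hQcard : #Q = d * (d - 1) := hk q
  have h2 : #(P \ Q) = #(Q \ P) := card_sdiff_comm (hPcard.trans hQcard.symm)
  have h3 : (P \ Q) ∪ (Q \ P) ⊆ bridgeDiff (collinearityGraph G) p q := by
    intro t ht
    simp only [mem_union, mem_sdiff, hP, hQ, SimpleGraph.mem_neighborFinset] at ht
    rw [bridgeDiff, mem_filter_univ]
    unfold adjInd
    rcases ht with ⟨e1, e2⟩ | ⟨e1, e2⟩
    · refine ⟨e1.ne.symm, ?_, ?_⟩
      · rintro rfl; exact hpq' e1
      · rw [if_neg (mt (collinearityGraph G).adj_symm e2), if_pos e1.symm]; norm_num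
    · refine ⟨?_, e1.ne.symm, ?_⟩
      · rintro rfl; exact hpq' e1.symm
      · rw [if_neg (mt (collinearityGraph G).adj_symm e2), if_pos e1.symm]; norm_num
  have h4 := card_le_card h3
  rw [card_union_of_disjoint (disjoint_sdiff_sdiff)] at h4
  -- The two differences have equal size and at most three elements together.
  have h5 : #(P \ Q) ≤ 1 := by omega
  -- a common neighbour that is adjacent to all other neighbours of `p`
  obtain ⟨e, heP, heQ, he⟩ : ∃ e, e ∈ P ∧ e ∈ Q ∧ ∀ t ∈ P, t ∉ Q → (collinearityGraph G).Adj e t := by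
    rcases (P \ Q).eq_empty_or_nonempty with h6 | ⟨s, hs⟩
    · refine ⟨a, by simpa [hP] using hap.symm, by simpa [hQ] using haq.symm, fun t ht ht' => ?_⟩
      have : t ∈ P \ Q := mem_sdiff.2 ⟨ht, ht'⟩
      simp [h6] at this
    · have hsuniq : ∀ t ∈ P, t ∉ Q → t = s := fun t ht ht' =>
        card_le_one.1 h5 t (mem_sdiff.2 ⟨ht, ht'⟩) s hs
      rw [mem_sdiff] at hs
      have hsp : (collinearityGraph G).Adj p s := by simpa [hP] using hs.1
      obtain ⟨w, hw1, hw2⟩ := hsp.2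
      -- A third point `e` of the line `w` through `p` and `s` exists because `d ≥ 3`. It is
      -- collinear with `p` and differs from `s`, the only neighbour of `p` that is not a neighbour
      -- of `q`.
      obtain ⟨e, he⟩ : (((G.neighborFinset w).erase p).erase s).Nonempty := by
        rw [← card_pos, card_erase_of_mem (by simp [hw2.symm, hsp.ne.symm]),
          card_erase_of_mem (by simp [hw1.symm]), SimpleGraph.card_neighborFinset_eq_degree, hd]
        omega
      simp only [mem_erase, SimpleGraph.mem_neighborFinset] at he
      obtain ⟨hes, hep, hew⟩ := he
      have hePmem : e ∈ P := by
        rw [hP, SimpleGraph.mem_neighborFinset]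
        exact ⟨hep.symm, w, hw1, hew.symm⟩
      refine ⟨e, hePmem, ?_, ?_⟩
      · by_contra heQ
        exact hes (hsuniq e hePmem heQ)
      · intro t ht ht'
        rw [hsuniq t ht ht']
        exact ⟨hes, w, hew.symm, hw2⟩
  have hep : (collinearityGraph G).Adj e p := by simpa [hP] using (SimpleGraph.mem_neighborFinset _ _ _).1 heP |>.symm
  have heq : (collinearityGraph G).Adj e q := by simpa [hQ] using (SimpleGraph.mem_neighborFinset _ _ _).1 heQ |>.symm
  -- Then `e` has one neighbour more than regularity allows: `p`, `q`, and all other neighbours of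
  -- `p`.
  have h6 : insert p (insert q (P.erase e)) ⊆ (collinearityGraph G).neighborFinset e := by
    intro t ht
    rw [SimpleGraph.mem_neighborFinset]
    simp only [mem_insert, mem_erase] at ht
    rcases ht with rfl | rfl | ⟨hte, htP⟩
    · exact hep
    · exact heq
    · by_cases htQ : t ∈ Q
      · exact hH.adj_of_square hpq hpq' (Ne.symm hte) hep heq
          ((SimpleGraph.mem_neighborFinset _ _ _).1 htP).symm
          ((SimpleGraph.mem_neighborFinset _ _ _).1 htQ).symm
      · exact he t htP htQ
  have h7 := card_le_card h6
  rw [card_insert_of_notMem (by simp [hpq, hP]), card_insert_of_notMem (by simp [hP, hpq']),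
    card_erase_of_mem heP, hPcard, SimpleGraph.card_neighborFinset_eq_degree, hk e] at h7
  have h8 : 0 < d * (d - 1) := Nat.mul_pos (by omega) (by omega)
  omega

end Collinearity

/-! ### Transitivity of collinearity in degree at least four. -/

section Geometry

variable {V : Type*} [Fintype V] [DecidableEq V] {G : SimpleGraph V} [DecidableRel G.Adj] {d : ℕ}

/-- A `d`-regular graph without four-cycles whose collinearity graph satisfies the local
conditions that hold if its least eigenvalue is larger than `-2`. The vertices are regarded both
as points and as lines, with adjacency as incidence. -/
structure IsTightSpace (G : SimpleGraph V) [DecidableRel G.Adj] (d : ℕ) : Prop where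
  three_le : 3 ≤ d
  deg : ∀ v, G.degree v = d
  linear : IsLinearSpace G
  claw : ∀ ⦃r p q s : V⦄, (collinearityGraph G).Adj r p → (collinearityGraph G).Adj r q →
    (collinearityGraph G).Adj r s → p ≠ q → p ≠ s → q ≠ s → ¬ (collinearityGraph G).Adj p q →
    ¬ (collinearityGraph G).Adj p s → (collinearityGraph G).Adj q s
  triple : ∀ ⦃p q a b c : V⦄, p ≠ q → ¬ (collinearityGraph G).Adj p q → a ≠ b → a ≠ c → b ≠ c →
    (collinearityGraph G).Adj a p → (collinearityGraph G).Adj a q →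
    (collinearityGraph G).Adj b p → (collinearityGraph G).Adj b q →
    (collinearityGraph G).Adj c p → (collinearityGraph G).Adj c q → False
  square : ∀ ⦃p q r s : V⦄, p ≠ q → ¬ (collinearityGraph G).Adj p q → r ≠ s →
    (collinearityGraph G).Adj r p → (collinearityGraph G).Adj r q →
    (collinearityGraph G).Adj s p → (collinearityGraph G).Adj s q →
    (collinearityGraph G).Adj r s
  triangles : ∀ ⦃a b c e u v : V⦄, (collinearityGraph G).Adj a b → (collinearityGraph G).Adj a c →
    (collinearityGraph G).Adj a e → (collinearityGraph G).Adj b c →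
    (collinearityGraph G).Adj b e → (collinearityGraph G).Adj c e →
    (collinearityGraph G).Adj u a → (collinearityGraph G).Adj u b →
    (collinearityGraph G).Adj v c → (collinearityGraph G).Adj v e →
    ¬ (collinearityGraph G).Adj u c → ¬ (collinearityGraph G).Adj u e →
    ¬ (collinearityGraph G).Adj v a → ¬ (collinearityGraph G).Adj v b → False

theorem isTightSpace_of_expansion (hd3 : 3 ≤ d) (hd : ∀ v, G.degree v = d)
    (hexp : ∀ f : V → ℝ, f ≠ 0 →
      ((d : ℝ) - 2) * ∑ v, f v ^ 2 < ∑ w, (∑ v ∈ G.neighborFinset w, f v) ^ 2) :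
    IsTightSpace G d := by
  have hH := gramPos_collinearityGraph hexp hd
  have hG := isLinearSpace_of_expansion hexp hd
  refine ⟨hd3, hd, hG, ?_, fun p q a b c => false_of_three_common hd hd3 hG hH, ?_, ?_⟩
  · intro r p q s h1 h2 h3 h4 h5 h6 h7 h8
    by_contra h9
    -- The valency of the collinearity graph is at least six, above the threshold five for excluding
    -- claws.
    have h10 : 3 * 2 ≤ d * (d - 1) := Nat.mul_le_mul hd3 (by omega)
    exact hH.not_isClaw (hG.isRegularOfDegree hd) (by omega) ⟨h4, h5, h6, h1, h2, h3, h7, h8, h9⟩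
  · intro p q r s h1 h2 h3 h4 h5 h6 h7
    exact hH.adj_of_square h1 h2 h3 h4 h5 h6 h7
  · intro a b c e u v h1 h2 h3 h4 h5 h6 h7 h8 h9 h10 h11 h12 h13 h14
    exact hH.false_of_two_triangles h1 h2 h3 h4 h5 h6 h7 h8 h9 h10 h11 h12 h13 h14

namespace IsTightSpace

omit [Fintype V] [DecidableEq V] [DecidableRel G.Adj] in
lemma coll {x y w : V} (hx : G.Adj x w) (hy : G.Adj y w) (h : x ≠ y) :
    (collinearityGraph G).Adj x y := ⟨h, w, hx, hy⟩

variable (hG : IsTightSpace G d)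
include hG

lemma exists_third_line {r l m : V} : ∃ n, G.Adj r n ∧ n ≠ l ∧ n ≠ m := by
  obtain ⟨n, hn⟩ : (((G.neighborFinset r).erase l).erase m).Nonempty := by
    rw [← card_pos]
    have h1 := pred_card_le_card_erase (s := G.neighborFinset r) (a := l)
    have h2 := pred_card_le_card_erase (s := (G.neighborFinset r).erase l) (a := m)
    rw [SimpleGraph.card_neighborFinset_eq_degree, hG.deg] at h1
    have := hG.three_le
    omega
  simp only [mem_erase, SimpleGraph.mem_neighborFinset] at hn
  exact ⟨n, hn.2.2, hn.2.1, hn.1⟩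

-- If `p` were not collinear with `z`, then `a`, `b`, `c` would be three common neighbours of the
-- pair `p`, `z`.
omit [DecidableEq V] in
lemma adj_line_of_three {p n a b c z : V} (hpn : ¬ G.Adj p n) (ha : G.Adj a n) (hb : G.Adj b n)
    (hc : G.Adj c n) (hz : G.Adj z n) (hab : a ≠ b) (hac : a ≠ c) (hbc : b ≠ c)
    (hpa : (collinearityGraph G).Adj p a) (hpb : (collinearityGraph G).Adj p b)
    (hpc : (collinearityGraph G).Adj p c) : (collinearityGraph G).Adj p z := by
  by_contra hpz
  have h1 : ∀ {x}, (collinearityGraph G).Adj p x → G.Adj x n →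
      (collinearityGraph G).Adj x z := by
    intro x hx hxn
    exact coll hxn hz (by rintro rfl; exact hpz hx)
  exact hG.triple (by rintro rfl; exact hpn hz) hpz hab hac hbc hpa.symm (h1 hpa ha) hpb.symm
    (h1 hpb hb) hpc.symm (h1 hpc hc)

/-- If `r` is collinear with all points of a line `u`, then all lines through `r` meet `u`. -/
lemma exists_meet {r u m : V} (hru : ¬ G.Adj r u)
    (h : ∀ z, G.Adj z u → (collinearityGraph G).Adj r z) (hm : G.Adj r m) :
    ∃ z, G.Adj z u ∧ G.Adj z m := by
  choose! f hf1 hf2 using fun z hz => (h z hz).2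
  have hinj : Set.InjOn f (G.neighborFinset u) := by
    intro x hx y hy hxy
    rw [mem_coe, SimpleGraph.mem_neighborFinset] at hx hy
    by_contra hne
    have h1 := hf2 y hy.symm
    rw [← hxy] at h1
    have h2 := hG.linear hne (hf2 x hx.symm) h1 hx.symm hy.symm
    exact hru (h2 ▸ hf1 x hx.symm)
  have hsub : (G.neighborFinset u).image f ⊆ G.neighborFinset r := by
    intro y hy
    obtain ⟨x, hx, rfl⟩ := mem_image.1 hy
    rw [SimpleGraph.mem_neighborFinset] at hx ⊢
    exact hf1 x hx.symm
  have heq : (G.neighborFinset u).image f = G.neighborFinset r := by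
    refine eq_of_subset_of_card_le hsub ?_
    rw [card_image_of_injOn hinj, SimpleGraph.card_neighborFinset_eq_degree,
      SimpleGraph.card_neighborFinset_eq_degree, hG.deg, hG.deg]
  have hm' : m ∈ (G.neighborFinset u).image f := by
    rw [heq, SimpleGraph.mem_neighborFinset]; exact hm
  obtain ⟨z, hz, rfl⟩ := mem_image.1 hm'
  rw [SimpleGraph.mem_neighborFinset] at hz
  exact ⟨z, hz.symm, hf2 z hz.symm⟩

/-- Otherwise, the degrees being equal, `p` and `r` would have the same neighbours apart from each
other, and `q` would be collinear with `p`. -/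
lemma exists_not_adj {p q r : V} (hrq : (collinearityGraph G).Adj r q)
    (hrp : (collinearityGraph G).Adj r p) (hpq : p ≠ q)
    (hpq' : ¬ (collinearityGraph G).Adj p q) :
    ∃ x, (collinearityGraph G).Adj p x ∧ r ≠ x ∧ ¬ (collinearityGraph G).Adj r x := by
  by_contra! hcon
  have hreg := hG.linear.isRegularOfDegree hG.deg
  set S := (collinearityGraph G).neighborFinset p with hS
  set T := (collinearityGraph G).neighborFinset r with hT
  have hrS : r ∈ S := by simpa [hS] using hrp.symm
  have hpT : p ∈ T := by simpa [hT] using hrp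
  have h1 : S.erase r ⊆ T.erase p := by
    intro x hx
    rw [mem_erase, hS, SimpleGraph.mem_neighborFinset] at hx
    rw [mem_erase, hT, SimpleGraph.mem_neighborFinset]
    exact ⟨hx.2.ne.symm, hcon x hx.2 hx.1.symm⟩
  have h2 : S.erase r = T.erase p := by
    refine eq_of_subset_of_card_le h1 ?_
    rw [card_erase_of_mem hrS, card_erase_of_mem hpT, hS, hT,
      SimpleGraph.card_neighborFinset_eq_degree, SimpleGraph.card_neighborFinset_eq_degree,
      hreg, hreg]
  have h3 : q ∈ T.erase p := by
    rw [mem_erase, hT, SimpleGraph.mem_neighborFinset]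
    exact ⟨hpq.symm, hrq⟩
  rw [← h2, mem_erase, hS, SimpleGraph.mem_neighborFinset] at h3
  exact hpq' h3.2

/-- In degree at least four, a point `p` collinear with all points of a line through `r` is
collinear with all points collinear with `r`. -/
lemma false_of_full_line (hd4 : 4 ≤ d) {p q r m n : V} (hpq : p ≠ q)
    (hpq' : ¬ (collinearityGraph G).Adj p q) (hrp : (collinearityGraph G).Adj r p)
    (hrm : G.Adj r m) (hqm : G.Adj q m) (hqr : r ≠ q) (hrn : G.Adj r n)
    (hpn : ¬ G.Adj p n) (hfull : ∀ z, G.Adj z n → (collinearityGraph G).Adj p z) : False := by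
  have hrq : (collinearityGraph G).Adj r q := coll hrm hqm hqr
  obtain ⟨x, hpx, hrx, hrx'⟩ := hG.exists_not_adj hrq hrp hpq hpq'
  -- The line `u` through `p` and `s` meets `m` in a point `z`, which is a common neighbour of `p`
  -- and `q` other than `r`.
  have key : ∀ s, G.Adj s n → s ≠ r → ¬ (collinearityGraph G).Adj s x →
      ∃ z u, G.Adj p u ∧ G.Adj s u ∧ G.Adj z u ∧ z ≠ r ∧ (collinearityGraph G).Adj z p ∧
        (collinearityGraph G).Adj z q := by
    intro s hsn hsr hsx
    have hps := hfull s hsn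
    obtain ⟨-, u, hpu, hsu⟩ := hps
    have hru : ¬ G.Adj r u := fun hru => hpn (hG.linear hsr hsu hru hsn hrn ▸ hpu)
    have hrs : (collinearityGraph G).Adj r s := coll hrn hsn hsr.symm
    have hps := hfull s hsn
    have hall : ∀ z, G.Adj z u → (collinearityGraph G).Adj r z := by
      intro z₀ hz₀
      by_contra hrz₀
      have hno : ∀ z, G.Adj z u → z ≠ p → z ≠ s → ¬ (collinearityGraph G).Adj r z := by
        intro z hz hzp hzs hrz
        exact hrz₀ (hG.adj_line_of_three hru hpu hsu hz hz₀ hps.ne hzp.symm hzs.symm hrp hrs hrz)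
      -- No claw at `p` has leaves `r`, `x`, `z`. Then `p` and two such `z` are three common
      -- neighbours of `s` and `x`; here `d ≥ 4` provides the second `z`.
      have hxz : ∀ z, G.Adj z u → z ≠ p → z ≠ s → (collinearityGraph G).Adj z x := by
        intro z hz hzp hzs
        have hxz : x ≠ z := by
          rintro rfl
          exact hsx (coll hsu hz hzs.symm)
        exact (hG.claw hrp.symm hpx (coll hpu hz hzp.symm) hrx
          (by rintro rfl; exact hru hz) hxz hrx' (hno z hz hzp hzs)).symm
      obtain ⟨z₁, h₁, z₂, h₂, h₁₂⟩ := one_lt_card.1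
        (show 1 < #(((G.neighborFinset u).erase p).erase s) by
          have h1 := pred_card_le_card_erase (s := G.neighborFinset u) (a := p)
          have h2 := pred_card_le_card_erase (s := (G.neighborFinset u).erase p) (a := s)
          rw [SimpleGraph.card_neighborFinset_eq_degree, hG.deg] at h1
          omega)
      simp only [mem_erase, SimpleGraph.mem_neighborFinset] at h₁ h₂
      refine hG.triple (p := s) (q := x) ?_ hsx (Ne.symm h₁.2.1) (Ne.symm h₂.2.1) h₁₂ hps hpx
        (coll h₁.2.2.symm hsu h₁.1) (hxz z₁ h₁.2.2.symm h₁.2.1 h₁.1)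
        (coll h₂.2.2.symm hsu h₂.1) (hxz z₂ h₂.2.2.symm h₂.2.1 h₂.1)
      rintro rfl
      exact hrx' hrs
    obtain ⟨z, hzu, hzm⟩ := hG.exists_meet hru hall hrm
    refine ⟨z, u, hpu, hsu, hzu, ?_, coll hzu hpu ?_, coll hzm hqm ?_⟩
    · rintro rfl; exact hru hzu
    · rintro rfl; exact hpq' (coll hzm hqm hpq)
    · rintro rfl; exact hpq' (coll hpu hzu hpq)
  obtain ⟨s₁, h₁, s₂, h₂, h₁₂⟩ : ∃ s₁, (G.Adj s₁ n ∧ s₁ ≠ r ∧ ¬ (collinearityGraph G).Adj s₁ x) ∧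
      ∃ s₂, (G.Adj s₂ n ∧ s₂ ≠ r ∧ ¬ (collinearityGraph G).Adj s₂ x) ∧ s₁ ≠ s₂ := by
    set S := (G.neighborFinset n).erase r with hS
    have hScard : 3 ≤ #S := by
      rw [hS, card_erase_of_mem (by simpa using hrn.symm),
        SimpleGraph.card_neighborFinset_eq_degree, hG.deg]
      omega
    -- Two such points together with `p` would be three common neighbours of `r` and `x`.
    have hbad : #(S.filter fun s => (collinearityGraph G).Adj s x) ≤ 1 := by
      rw [card_le_one]
      intro a ha b hb
      by_contra hab
      simp only [hS, mem_filter, mem_erase, SimpleGraph.mem_neighborFinset] at ha hb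
      refine hG.triple hrx hrx' (a := p) ?_ ?_ hab hrp.symm hpx
        (coll ha.1.2.symm hrn ha.1.1) ha.2 (coll hb.1.2.symm hrn hb.1.1) hb.2
      · rintro rfl; exact hpn ha.1.2.symm
      · rintro rfl; exact hpn hb.1.2.symm
    have hsplit := card_filter_add_card_filter_not (s := S)
      (fun s => (collinearityGraph G).Adj s x)
    obtain ⟨a, ha, b, hb, hab⟩ := one_lt_card.1
      (show 1 < #(S.filter fun s => ¬ (collinearityGraph G).Adj s x) by omega)
    simp only [hS, mem_filter, mem_erase, SimpleGraph.mem_neighborFinset] at ha hb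
    exact ⟨a, ⟨ha.1.2.symm, ha.1.1, ha.2⟩, b, ⟨hb.1.2.symm, hb.1.1, hb.2⟩, hab⟩
  obtain ⟨z₁, u₁, a1, a2, a3, a4, a5, a6⟩ := key s₁ h₁.1 h₁.2.1 h₁.2.2
  obtain ⟨z₂, u₂, b1, b2, b3, b4, b5, b6⟩ := key s₂ h₂.1 h₂.2.1 h₂.2.2
  have hz : z₁ ≠ z₂ := by
    rintro rfl
    have h3 : u₁ = u₂ := hG.linear a5.ne a3 a1 b3 b1
    subst h3
    exact hpn (hG.linear h₁₂ a2 b2 h₁.1 h₂.1 ▸ a1)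
  exact hG.triple hpq hpq' (Ne.symm a4) (Ne.symm b4) hz hrp hrq a5 a6 b5 b6

/-- Take a line `n` through `r` containing neither `p` nor `q`. By claw-freeness each of its `d - 1
≥ 3` other points is collinear with `p` or `q`, so one of the two is collinear with at least two of
them and with `r`, hence with the whole line; `false_of_full_line` applies. -/
lemma adj_of_common_of_four_le (hd4 : 4 ≤ d) {p q r : V} (hrp : (collinearityGraph G).Adj r p)
    (hrq : (collinearityGraph G).Adj r q) (hpq : p ≠ q) : (collinearityGraph G).Adj p q := by
  by_contra hpq'
  obtain ⟨hrp', l, hrl, hpl⟩ := hrp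
  obtain ⟨hrq', m, hrm, hqm⟩ := hrq
  obtain ⟨n, hrn, hnl, hnm⟩ := hG.exists_third_line (r := r) (l := l) (m := m)
  have hpn : ¬ G.Adj p n := fun h => hnl (hG.linear hrp' hrn h hrl hpl)
  have hqn : ¬ G.Adj q n := fun h => hnm (hG.linear hrq' hrn h hrm hqm)
  have hrp := coll hrl hpl hrp'
  have hrq := coll hrm hqm hrq'
  set S := (G.neighborFinset n).erase r with hS
  have hScard : 3 ≤ #S := by
    rw [hS, card_erase_of_mem (by simpa using hrn.symm),
      SimpleGraph.card_neighborFinset_eq_degree, hG.deg]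
    omega
  have hcover : S ⊆ (S.filter fun s => (collinearityGraph G).Adj p s) ∪
      S.filter fun s => (collinearityGraph G).Adj q s := by
    intro s hs
    simp only [mem_union, mem_filter]
    by_cases hps : (collinearityGraph G).Adj p s
    · exact Or.inl ⟨hs, hps⟩
    · refine Or.inr ⟨hs, ?_⟩
      simp only [hS, mem_erase, SimpleGraph.mem_neighborFinset] at hs
      refine hG.claw hrp hrq (coll hrn hs.2.symm (Ne.symm hs.1)) hpq ?_ ?_ hpq' hps
      · rintro rfl; exact hpn hs.2.symm
      · rintro rfl; exact hqn hs.2.symm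
  have hfull : ∀ x, ¬ G.Adj x n → (collinearityGraph G).Adj r x →
      1 < #(S.filter fun s => (collinearityGraph G).Adj x s) →
      ∀ z, G.Adj z n → (collinearityGraph G).Adj x z := by
    intro x hxn hrx hx z hz
    obtain ⟨a, ha, b, hb, hab⟩ := one_lt_card.1 hx
    simp only [hS, mem_filter, mem_erase, SimpleGraph.mem_neighborFinset] at ha hb
    exact hG.adj_line_of_three hxn hrn ha.1.2.symm hb.1.2.symm hz (Ne.symm ha.1.1)
      (Ne.symm hb.1.1) hab hrx.symm ha.2 hb.2
  have h1 := (card_le_card hcover).trans (card_union_le _ _)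
  by_cases h2 : 1 < #(S.filter fun s => (collinearityGraph G).Adj p s)
  · exact hG.false_of_full_line hd4 hpq hpq' hrp hrm hqm hrq' hrn hpn (hfull p hpn hrp h2)
  · exact hG.false_of_full_line hd4 hpq.symm (mt SimpleGraph.Adj.symm hpq') hrq hrl hpl hrp' hrn
      hqn (hfull q hqn hrq (by omega))

end IsTightSpace

end Geometry

/-! ### Transitivity of collinearity in degree three. -/

section Cubic

variable {V : Type*} [Fintype V] [DecidableEq V] {G : SimpleGraph V} [DecidableRel G.Adj]

namespace IsTightSpace

variable (hG : IsTightSpace G 3)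
include hG

lemma exists_third_point (v v' w : V) :
    ∃ a, a ≠ v ∧ a ≠ v' ∧ G.Adj a w := by
  obtain ⟨a, h1, h2, h3⟩ := hG.exists_third_line (r := w) (l := v) (m := v')
  exact ⟨a, h2, h3, h1.symm⟩

lemma eq_of_three_lines {v a b c z : V} (ha : G.Adj v a) (hb : G.Adj v b) (hc : G.Adj v c)
    (hab : a ≠ b) (hac : a ≠ c) (hbc : b ≠ c) (hz : G.Adj v z) : z = a ∨ z = b ∨ z = c := by
  have h1 : ({a, b, c} : Finset V) = G.neighborFinset v := by
    refine eq_of_subset_of_card_le ?_ ?_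
    · intro x hx
      simp only [mem_insert, mem_singleton] at hx
      rw [SimpleGraph.mem_neighborFinset]
      rcases hx with rfl | rfl | rfl <;> assumption
    · rw [SimpleGraph.card_neighborFinset_eq_degree, hG.deg, card_insert_of_notMem (by simp [hab, hac]),
        card_insert_of_notMem (by simp [hbc]), card_singleton]
  have h2 : z ∈ ({a, b, c} : Finset V) := by
    rw [h1, SimpleGraph.mem_neighborFinset]; exact hz
  simpa using h2

/-- The configuration in which `p` is collinear with all points of the line `n`, `r` is a point of
`n`, the third line `m` through `r` contains `q` and `q'`, and `q'` lies on the line through `p`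
and `s`. -/
lemma false_of_full_line_cubic_of_mem {p q r q' s s' a' l m n u u' : V} (hpq : p ≠ q)
    (hpq' : ¬ (collinearityGraph G).Adj p q) (hrp : r ≠ p) (hrq : r ≠ q) (hqq : q' ≠ r)
    (hqq' : q' ≠ q) (hss : s ≠ r) (hss' : s' ≠ r) (hs : s ≠ s')
    (hrl : G.Adj r l) (hpl : G.Adj p l) (hrm : G.Adj r m) (hqm : G.Adj q m) (hqm' : G.Adj q' m)
    (hrn : G.Adj r n) (hsn : G.Adj s n) (hsn' : G.Adj s' n) (hln : n ≠ l) (hmn : n ≠ m)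
    (hlm : l ≠ m) (hps : p ≠ s) (hps' : p ≠ s') (hpu : G.Adj p u) (hsu : G.Adj s u)
    (hqu : G.Adj q' u) (hpu' : G.Adj p u') (hsu' : G.Adj s' u') (hau' : G.Adj a' u')
    (hap : a' ≠ p) (has : a' ≠ s') (hra : r ≠ a') (hra' : ¬ (collinearityGraph G).Adj r a') :
    False := by
  obtain ⟨p', hpr', hpp', hpl'⟩ := hG.exists_third_point r p l
  have hpn : ¬ G.Adj p n := fun h => hln (hG.linear hrp hrn h hrl hpl)
  have hpm : ¬ G.Adj p m := fun h => hpq' (coll h hqm hpq)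
  have hpn' : ¬ G.Adj p' n := fun h => hln (hG.linear hpr' h hrn hpl' hrl)
  have hpm' : ¬ G.Adj p' m := fun h => hlm (hG.linear hpr' hpl' hrl h hrm)
  have hsl : ¬ G.Adj s l := fun h => hln (hG.linear hss hsn hrn h hrl)
  have hsl' : ¬ G.Adj s' l := fun h => hln (hG.linear hss' hsn' hrn h hrl)
  have hql' : ¬ G.Adj q' l := fun h => hlm (hG.linear hqq h hrl hqm' hrm)
  have hqn' : ¬ G.Adj q' n := fun h => hmn (hG.linear hqq h hrn hqm' hrm)
  have hlu : l ≠ u := by rintro rfl; exact hsl hsu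
  have hlu' : l ≠ u' := by rintro rfl; exact hsl' hsu'
  have huu : u ≠ u' := by
    rintro rfl
    exact hpn (hG.linear hs hsu hsu' hsn hsn' ▸ hpu)
  have hqp : q' ≠ p := by rintro rfl; exact hpm hqm'
  have hqs : q' ≠ s := by rintro rfl; exact hqn' hsn
  have hqs' : q' ≠ s' := by rintro rfl; exact hqn' hsn'
  have hpu'' : ¬ G.Adj p' u := fun h => hlu (hG.linear hpp' hpl' hpl h hpu)
  have cr_p := coll hrl hpl hrp
  have cr_q := coll hrm hqm hrq
  have cr_q' := coll hrm hqm' hqq.symm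
  have cr_p' := coll hrl hpl' hpr'.symm
  have cr_s := coll hrn hsn hss.symm
  have cr_s' := coll hrn hsn' hss'.symm
  have cp_s := coll hpu hsu hps
  have cp_s' := coll hpu' hsu' hps'
  have cp_q' := coll hpu hqu hqp.symm
  have cp_p' := coll hpl hpl' hpp'.symm
  have cp_a' := coll hpu' hau' hap.symm
  have cs_a' := coll hsu' hau' has.symm
  have cq_q' := coll hqm hqm' hqq'.symm
  -- The pair `r`, `a'` already has the common neighbours `p`, `s'`, and the pair `p`, `q` has `r`,
  -- `q'`. A third is impossible in either case.
  have na : ∀ {t}, t ≠ p → t ≠ s' → (collinearityGraph G).Adj t r →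
      ¬ (collinearityGraph G).Adj t a' := fun h1 h2 h3 h4 =>
    hG.triple hra hra' h1.symm hps' h2 cr_p.symm cp_a' h3 h4 cr_s'.symm cs_a'
  have nq : ∀ {t}, t ≠ r → t ≠ q' → (collinearityGraph G).Adj t p →
      ¬ (collinearityGraph G).Adj t q := fun h1 h2 h3 h4 =>
    hG.triple hpq hpq' h1.symm hqq.symm h2 cr_p cr_q h3 h4 cp_q'.symm cq_q'.symm
  have hps2 : p' ≠ s := by rintro rfl; exact hpn' hsn
  have hps2' : p' ≠ s' := by rintro rfl; exact hpn' hsn'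
  have hpq2' : p' ≠ q' := by rintro rfl; exact hpm' hqm'
  have hpq2 : p' ≠ q := by rintro rfl; exact hpm' hqm
  have np_q := nq hpr' hpq2' cp_p'.symm
  have ns_q := nq hss hqs.symm cp_s.symm
  have ns_q' := nq hss' hqs'.symm cp_s'.symm
  have np_a := na hpp' hps2' cr_p'.symm
  have nq_a := na hqp hqs' cr_q'.symm
  have hqs2 : q ≠ s := by rintro rfl; exact hpq' cp_s
  have hqs2' : q ≠ s' := by rintro rfl; exact hpq' cp_s'
  have cp_s2 := hG.claw cr_q cr_p' cr_s hpq2.symm hqs2 hps2 (fun h => np_q h.symm)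
    fun h => ns_q h.symm
  have cp_s2' := hG.claw cr_q cr_p' cr_s' hpq2.symm hqs2' hps2' (fun h => np_q h.symm)
    fun h => ns_q' h.symm
  have hpa2 : p' ≠ a' := by rintro rfl; exact hra' cr_p'
  have hqa2 : q' ≠ a' := by rintro rfl; exact hra' cr_q'
  have cp_q2 := hG.claw cp_a' cp_p' cp_q' hpa2.symm hqa2.symm hpq2' (fun h => np_a h.symm)
    fun h => nq_a h.symm
  obtain ⟨-, g₁, h1, h1'⟩ := cp_s2
  obtain ⟨-, g₂, h2, h2'⟩ := cp_s2'
  obtain ⟨-, g₃, h3, h3'⟩ := cp_q2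
  have e1 : l ≠ g₁ := by rintro rfl; exact hsl h1'
  have e2 : l ≠ g₂ := by rintro rfl; exact hsl' h2'
  have e12 : g₁ ≠ g₂ := by
    rintro rfl
    exact hpn' (hG.linear hs h1' h2' hsn hsn' ▸ h1)
  -- The lines through `p'` are `l`, `g₁`, `g₂`. The line joining `p'` to `q'` is not `l`, and if it
  -- were `g₁` it would be the line `u` through `q'` and `s`, which misses `p'`. So `q'` and `s'`
  -- are collinear.
  have e3 : g₃ = g₂ := by
    rcases hG.eq_of_three_lines hpl' h1 h2 e1 e2 e12 h3 with e | e | e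
    · exact absurd (e ▸ h3') hql'
    · subst e
      exact absurd (hG.linear hqs h3' h1' hqu hsu ▸ h3) hpu''
    · exact e
  subst e3
  have cq_s' := coll h3' h2' hqs'
  -- The clique `r, q', p, s'` has the triangle with apex `q` on `r, q'` and the triangle with apex
  -- `a'` on `p, s'`.
  exact hG.triangles cr_q' cr_p cr_s' cp_q'.symm cq_s' cp_s' cr_q.symm cq_q' cp_a'.symm cs_a'.symm
    (fun h => hpq' h.symm) (fun h => ns_q' h.symm) (fun h => hra' h.symm) (fun h => nq_a h.symm)

/-- Consider the third points `a`, `a'` of the lines `ps` and `ps'`. If one is collinear with `r`,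
it is the third point of `m`, which is the preceding configuration. If neither is, then `s, s', a',
a` is an induced four-cycle. -/
lemma false_of_full_line_cubic {p q r s s' l m n : V} (hpq : p ≠ q)
    (hpq' : ¬ (collinearityGraph G).Adj p q) (hrp : r ≠ p) (hrq : r ≠ q)
    (hss : s ≠ r) (hss' : s' ≠ r) (hs : s ≠ s')
    (hrl : G.Adj r l) (hpl : G.Adj p l) (hrm : G.Adj r m) (hqm : G.Adj q m)
    (hrn : G.Adj r n) (hsn : G.Adj s n) (hsn' : G.Adj s' n) (hln : n ≠ l) (hmn : n ≠ m)
    (hps : (collinearityGraph G).Adj p s) (hps' : (collinearityGraph G).Adj p s') : False := by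
  obtain ⟨q', hqq, hqq', hqm'⟩ := hG.exists_third_point r q m
  obtain ⟨hps1, u, hpu, hsu⟩ := hps
  obtain ⟨hps1', u', hpu', hsu'⟩ := hps'
  obtain ⟨a, hap, has, hau⟩ := hG.exists_third_point p s u
  obtain ⟨a', hap', has', hau'⟩ := hG.exists_third_point p s' u'
  have hlm : l ≠ m := by rintro rfl; exact hpq' (coll hpl hqm hpq)
  have hpn : ¬ G.Adj p n := fun h => hln (hG.linear hrp hrn h hrl hpl)
  have hsl : ¬ G.Adj s l := fun h => hln (hG.linear hss hsn hrn h hrl)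
  have hsl' : ¬ G.Adj s' l := fun h => hln (hG.linear hss' hsn' hrn h hrl)
  have hlu : l ≠ u := by rintro rfl; exact hsl hsu
  have hlu' : l ≠ u' := by rintro rfl; exact hsl' hsu'
  have huu : u ≠ u' := by
    rintro rfl
    exact hpn (hG.linear hs hsu hsu' hsn hsn' ▸ hpu)
  have cr_p := coll hrl hpl hrp
  have cp_s := coll hpu hsu hps1
  have cp_s' := coll hpu' hsu' hps1'
  have cp_a := coll hpu hau hap.symm
  have cp_a' := coll hpu' hau' hap'.symm
  have cr_s := coll hrn hsn hss.symm
  have cr_s' := coll hrn hsn' hss'.symm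
  have hra : r ≠ a := by rintro rfl; exact hlu (hG.linear hrp hrl hpl hau hpu)
  have hra' : r ≠ a' := by rintro rfl; exact hlu' (hG.linear hrp hrl hpl hau' hpu')
  have key : ∀ {t a u}, G.Adj p u → l ≠ u → G.Adj t u → G.Adj t n → G.Adj a u → a ≠ t → a ≠ p →
      r ≠ a → (collinearityGraph G).Adj r a → a = q' := by
    rintro t a u hpu hlu htu htn hau hat hap hra ⟨-, w, hrw, haw⟩
    rcases hG.eq_of_three_lines hrl hrm hrn hlm hln.symm hmn.symm hrw with rfl | rfl | rfl
    · exact absurd (hG.linear hap haw hpl hau hpu) hlu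
    · rcases hG.eq_of_three_lines hrw.symm hqm.symm hqm'.symm hrq hqq.symm hqq'.symm
        haw.symm with rfl | rfl | rfl
      · exact absurd rfl hra
      · exact absurd (coll hpu hau hpq) hpq'
      · rfl
    · exact absurd (hG.linear hat haw htn hau htu ▸ hpu) hpn
  have haa : a ≠ a' := by
    rintro rfl
    exact huu (hG.linear hap hau hpu hau' hpu')
  by_cases h1 : (collinearityGraph G).Adj r a
  · have h2 : ¬ (collinearityGraph G).Adj r a' := fun h2 =>
      haa ((key hpu hlu hsu hsn hau has hap hra h1).trans
        (key hpu' hlu' hsu' hsn' hau' has' hap' hra' h2).symm)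
    have h3 := key hpu hlu hsu hsn hau has hap hra h1
    exact hG.false_of_full_line_cubic_of_mem hpq hpq' hrp hrq hqq hqq' hss hss' hs hrl hpl hrm hqm
      hqm' hrn hsn hsn' hln hmn hlm hps1 hps1' hpu hsu (h3 ▸ hau) hpu' hsu' hau' hap' has' hra' h2
  by_cases h2 : (collinearityGraph G).Adj r a'
  · have h3 := key hpu' hlu' hsu' hsn' hau' has' hap' hra' h2
    exact hG.false_of_full_line_cubic_of_mem hpq hpq' hrp hrq hqq hqq' hss' hss hs.symm hrl hpl hrm
      hqm hqm' hrn hsn' hsn hln hmn hlm hps1' hps1 hpu' hsu' (h3 ▸ hau') hpu hsu hau hap has hra h1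
  -- Claw-freeness at `p` with leaves `r`, `a`, `a'`.
  have ca_a := hG.claw cr_p.symm cp_a cp_a' hra hra' haa h1 h2
  have ca_s := coll hau hsu has
  have ca_s' := coll hau' hsu' has'
  have hsa : s' ≠ a := by
    rintro rfl
    exact h1 cr_s'
  have hsa' : s ≠ a' := by
    rintro rfl
    exact h2 cr_s
  have n1 : ¬ (collinearityGraph G).Adj s' a := fun h =>
    hG.triple hra h1 hps1 hps1' hs cr_p.symm cp_a cr_s.symm ca_s.symm cr_s'.symm h
  have n2 : ¬ (collinearityGraph G).Adj s a' := fun h =>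
    hG.triple hra' h2 hps1' hps1 hs.symm cr_p.symm cp_a' cr_s'.symm ca_s'.symm cr_s.symm h
  exact n2 (hG.square hsa n1 hsa' (coll hsn hsn' hs) ca_s.symm ca_s' ca_a.symm)

/-- Each of `p`, `q` is collinear with at most one of the two other points of the third line through
`r`, and by claw-freeness each of these points is collinear with `p` or `q`. This leaves a matching,
which `key` excludes. -/
lemma adj_of_common_cubic {p q r : V} (hrp : (collinearityGraph G).Adj r p)
    (hrq : (collinearityGraph G).Adj r q) (hpq : p ≠ q) : (collinearityGraph G).Adj p q := by
  by_contra hpq'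
  obtain ⟨hrp', l, hrl, hpl⟩ := hrp
  obtain ⟨hrq', m, hrm, hqm⟩ := hrq
  obtain ⟨n, hrn, hnl, hnm⟩ := hG.exists_third_line (r := r) (l := l) (m := m)
  have hlm : l ≠ m := by rintro rfl; exact hpq' (coll hpl hqm hpq)
  have hpn : ¬ G.Adj p n := fun h => hnl (hG.linear hrp' hrn h hrl hpl)
  have hqn : ¬ G.Adj q n := fun h => hnm (hG.linear hrq' hrn h hrm hqm)
  have cr_p := coll hrl hpl hrp'
  have cr_q := coll hrm hqm hrq'
  obtain ⟨p', hpr, hpp, hpl'⟩ := hG.exists_third_point r p l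
  obtain ⟨q', hqr, hqq, hqm'⟩ := hG.exists_third_point r q m
  have hpm' : ¬ G.Adj p' m := fun h => hlm (hG.linear hpr hpl' hrl h hrm)
  have hpn' : ¬ G.Adj p' n := fun h => hnl (hG.linear hpr h hrn hpl' hrl)
  have hqn' : ¬ G.Adj q' n := fun h => hnm (hG.linear hqr h hrn hqm' hrm)
  have hpm : ¬ G.Adj p m := fun h => hpq' (coll h hqm hpq)
  have hql : ¬ G.Adj q l := fun h => hpq' (coll hpl h hpq)
  have cr_p' := coll hrl hpl' hpr.symm
  have cr_q' := coll hrm hqm' hqr.symm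
  have cp_p' := coll hpl' hpl hpp
  have cq_q' := coll hqm' hqm hqq
  have hpq2 : p ≠ q' := by rintro rfl; exact hpm hqm'
  have hpq3 : q ≠ p' := by rintro rfl; exact hql hpl'
  have hpq4 : p' ≠ q' := by rintro rfl; exact hpm' hqm'
  -- The same dichotomy, applied to the noncollinear pairs `s', p` and `s, q`, shows that `p` is
  -- collinear with `q'` and `q` with `p'`. Then `r`, `p'`, `q'` are three common neighbours of `p`
  -- and `q`.
  have key : ∀ s s', s ≠ r → s' ≠ r → s ≠ s' → G.Adj s n → G.Adj s' n →
      (collinearityGraph G).Adj p s → False := by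
    intro s s' hs hs' hss hsn hsn' hps
    have hps1 : p ≠ s := hps.ne
    have hps1' : p ≠ s' := by rintro rfl; exact hpn hsn'
    have hqs1 : q ≠ s := by rintro rfl; exact hqn hsn
    have hqs1' : q ≠ s' := by rintro rfl; exact hqn hsn'
    have hsq' : s' ≠ q' := by rintro rfl; exact hqn' hsn'
    have hsp' : s ≠ p' := by rintro rfl; exact hpn' hsn
    have cr_s := coll hrn hsn hs.symm
    have cr_s' := coll hrn hsn' hs'.symm
    have h1 : ¬ (collinearityGraph G).Adj p s' := fun h =>
      hG.false_of_full_line_cubic hpq hpq' hrp' hrq' hs hs' hss hrl hpl hrm hqm hrn hsn hsn' hnl hnm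
        hps h
    have h2 := hG.claw cr_p cr_q cr_s' hpq hps1' hqs1' hpq' h1
    have h3 : ¬ (collinearityGraph G).Adj q s := fun h =>
      hG.false_of_full_line_cubic hpq.symm (fun h => hpq' h.symm) hrq' hrp' hs hs' hss hrm hqm hrl
        hpl hrn hsn hsn' hnm hnl h h2
    have h4 : ¬ (collinearityGraph G).Adj s' q' := fun h =>
      hG.false_of_full_line_cubic hps1'.symm (fun h => h1 h.symm) hs'.symm hrp' hrq'.symm hqr
        hqq.symm hrn hsn' hrl hpl hrm hqm hqm' hnm.symm hlm.symm h2.symm h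
    have h5 := hG.claw cr_s' cr_p cr_q' hps1'.symm hsq' hpq2 (fun h => h1 h.symm) h4
    have h6 : ¬ (collinearityGraph G).Adj s p' := fun h =>
      hG.false_of_full_line_cubic hqs1.symm (fun h => h3 h.symm) hs.symm hrq' hrp'.symm hpr
        hpp.symm hrn hsn hrm hqm hrl hpl hpl' hnl.symm hlm hps.symm h
    have h7 := hG.claw cr_s cr_q cr_p' hqs1.symm hsp' hpq3 (fun h => h3 h.symm) h6
    exact hG.triple hpq hpq' hpr.symm hqr.symm hpq4 cr_p cr_q cp_p' h7.symm h5.symm cq_q'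
  obtain ⟨s, hs, -, hsn⟩ := hG.exists_third_point r r n
  obtain ⟨s', hs', hss, hsn'⟩ := hG.exists_third_point r s n
  have hps1 : p ≠ s := by rintro rfl; exact hpn hsn
  have hps1' : p ≠ s' := by rintro rfl; exact hpn hsn'
  have hqs1 : q ≠ s := by rintro rfl; exact hqn hsn
  have hqs1' : q ≠ s' := by rintro rfl; exact hqn hsn'
  have cr_s := coll hrn hsn hs.symm
  have cr_s' := coll hrn hsn' hs'.symm
  have n1 : ¬ (collinearityGraph G).Adj p s := fun h => key s s' hs hs' hss.symm hsn hsn' h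
  have n2 : ¬ (collinearityGraph G).Adj p s' := fun h => key s' s hs' hs hss hsn' hsn h
  exact hG.false_of_full_line_cubic hpq.symm (fun h => hpq' h.symm) hrq' hrp' hs hs' hss.symm hrm hqm
    hrl hpl hrn hsn hsn' hnm hnl (hG.claw cr_p cr_q cr_s hpq hps1 hqs1 hpq' n1)
    (hG.claw cr_p cr_q cr_s' hpq hps1' hqs1' hpq' n2)

end IsTightSpace

end Cubic

/-- In a graph without four-cycles that is regular of degree at least three and has no eigenvalues
in `[-√(d-2), √(d-2)]`, collinearity is transitive. -/
theorem IsTightSpace.adj_of_common {V : Type*} [Fintype V] [DecidableEq V] {G : SimpleGraph V}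
    [DecidableRel G.Adj] {d : ℕ} (hG : IsTightSpace G d) {p q r : V}
    (hrp : (collinearityGraph G).Adj r p) (hrq : (collinearityGraph G).Adj r q) (hpq : p ≠ q) :
    (collinearityGraph G).Adj p q := by
  rcases hG.three_le.eq_or_lt with h | h
  · subst h
    exact hG.adj_of_common_cubic hrp hrq hpq
  · exact hG.adj_of_common_of_four_le h hrp hrq hpq

/-! ### Excluding a single collinearity class. -/

section Friendship

variable {V : Type*} [Fintype V] [DecidableEq V] {G : SimpleGraph V} [DecidableRel G.Adj] {d : ℕ}

/-- The regular case of the friendship theorem. -/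
theorem IsLinearSpace.false_of_friendship (hG : IsLinearSpace G) (hd : ∀ v, G.degree v = d)
    (hd3 : 3 ≤ d) [Nonempty V] (hcommon : ∀ u v, ∃ w, G.Adj u w ∧ G.Adj v w) : False := by
  -- Modulo a prime divisor of `d - 1`, the relation `A² = (d - 1) + J` becomes `A² = J`.
  obtain ⟨p, hp, hpd⟩ := Nat.exists_prime_and_dvd (show d - 1 ≠ 1 by omega)
  have : Fact p.Prime := ⟨hp⟩
  have hd1 : (d : ZMod p) = 1 := by
    have h1 : ((d - 1 : ℕ) : ZMod p) = 0 := (ZMod.natCast_eq_zero_iff _ _).2 hpd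
    rw [Nat.cast_sub (by omega), sub_eq_zero, Nat.cast_one] at h1
    exact h1
  set A := G.adjMatrix (ZMod p) with hA
  set J : Matrix V V (ZMod p) := Matrix.of fun _ _ => 1 with hJ
  have hAA : A * A = J := by
    ext u v
    rw [hA, SimpleGraph.adjMatrix_mul_apply, hJ, Matrix.of_apply]
    have h1 : ∑ x ∈ G.neighborFinset u, G.adjMatrix (ZMod p) x v =
        #(G.neighborFinset u ∩ G.neighborFinset v) := by
      simp only [SimpleGraph.adjMatrix_apply, sum_boole]
      congr 2
      ext x
      simp [G.adj_comm x v]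
    rw [h1]
    rcases eq_or_ne u v with rfl | huv
    · rw [inter_self, SimpleGraph.card_neighborFinset_eq_degree, hd, hd1]
    · obtain ⟨w, h2, h3⟩ := hcommon u v
      have : G.neighborFinset u ∩ G.neighborFinset v = {w} := by
        ext x
        simp only [mem_inter, SimpleGraph.mem_neighborFinset, mem_singleton]
        exact ⟨fun h => hG huv h.1 h.2 h2 h3, by rintro rfl; exact ⟨h2, h3⟩⟩
      rw [this, card_singleton, Nat.cast_one]
  have hAJ : A * J = J := by
    ext u v
    rw [hA, SimpleGraph.adjMatrix_mul_apply, hJ]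
    simp [hd, hd1]
  have hpow : ∀ n, A ^ (n + 2) = J := by
    intro n
    induction n with
    | zero => rw [zero_add, sq, hAA]
    | succ n ih => rw [show n + 1 + 2 = (n + 2) + 1 by ring, pow_succ', ih, hAJ]
  -- In characteristic `p` the trace of `A ^ p = J` is the `p`-th power of the trace of `A`, which
  -- is `0`; but `J` has trace `d(d - 1) + 1 = 1`.
  have htr := ZMod.trace_pow_card A
  have hpowp : A ^ p = J := by
    have := hpow (p - 2)
    rwa [Nat.sub_add_cancel hp.two_le] at this
  rw [hpowp, hA, SimpleGraph.trace_adjMatrix,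
    zero_pow hp.ne_zero] at htr
  have hcard : Fintype.card V = d * (d - 1) + 1 := by
    obtain ⟨v⟩ := ‹Nonempty V›
    have h1 : (collinearityGraph G).neighborFinset v = univ.erase v := by
      ext x
      simp only [SimpleGraph.mem_neighborFinset, mem_erase, mem_univ, and_true]
      exact ⟨fun h => h.ne.symm, fun h => ⟨h.symm, hcommon v x⟩⟩
    have h2 := hG.isRegularOfDegree hd v
    rw [← SimpleGraph.card_neighborFinset_eq_degree, h1, card_erase_of_mem (mem_univ _),
      card_univ] at h2
    have : 0 < Fintype.card V := Fintype.card_pos_iff.2 ⟨v⟩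
    omega
  have htrJ : J.trace = 1 := by
    rw [Matrix.trace, hJ]
    simp only [Matrix.diag_apply, Matrix.of_apply, sum_const, card_univ, hcard, nsmul_eq_mul,
      mul_one]
    push_cast
    rw [(ZMod.natCast_eq_zero_iff _ _).2 hpd]
    simp
  rw [htrJ] at htr
  exact one_ne_zero htr

end Friendship

/-! ### Construction of the projective plane. -/

section Plane

/-- A connected tight space is the incidence graph of a projective plane. -/
theorem IsTightSpace.exists_projectivePlane {V : Type u} [Fintype V] [DecidableEq V]
    {G : SimpleGraph V} [DecidableRel G.Adj] {d : ℕ} (hG : IsTightSpace G d)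
    (hconn : G.Connected) :
    ∃ (P L : Type u) (_ : Finite P) (_ : Finite L) (_ : Membership P L)
      (_ : Configuration.ProjectivePlane P L), Configuration.ProjectivePlane.order P L = d - 1 ∧
        Nonempty (G ≃g incidenceGraph P L) := by
  have hlin := hG.linear
  have hthird := fun r l m : V => hG.exists_third_line (r := r) (l := l) (m := m)
  set E : V → V → Prop := fun u v => ∃ w, G.Adj u w ∧ G.Adj v w with hE
  have hrefl : ∀ u, E u u := fun u => by
    obtain ⟨w, hw, -⟩ := hthird u u u
    exact ⟨w, hw, hw⟩
  have hsymm : ∀ {u v}, E u v → E v u := fun h => h.imp fun _ h => h.symm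
  have htrans : ∀ {u v w}, E u v → E v w → E u w := by
    intro u v w huv hvw
    by_cases h1 : u = v
    · rwa [h1]
    by_cases h2 : v = w
    · rwa [← h2]
    by_cases h3 : u = w
    · rw [h3]; exact hrefl w
    exact (hG.adj_of_common (r := v) ⟨Ne.symm h1, hsymm huv⟩ ⟨h2, hvw⟩ h3).2
  -- Both `w` and `w'` lie in the class of neighbours of a common neighbour `z` of `u` and `v`, so
  -- adjacency induces a map on classes.
  have hcross : ∀ {u v w w'}, E u v → G.Adj u w → G.Adj v w' → E w w' := by
    rintro u v w w' ⟨z, huz, hvz⟩ hw hw'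
    exact htrans (v := z) ⟨u, hw.symm, huz.symm⟩ ⟨v, hvz.symm, hw'.symm⟩
  obtain ⟨v₀⟩ := hconn.nonempty
  obtain ⟨w₀, hvw, -⟩ := hthird v₀ v₀ v₀
  have hXY : ∀ v, E v₀ v ∨ E w₀ v := by
    intro v
    have hr := hconn.preconnected v₀ v
    rw [SimpleGraph.reachable_iff_reflTransGen] at hr
    induction hr with
    | refl => exact Or.inl (hrefl v₀)
    | tail _ hadj ih =>
      rcases ih with h | h
      · exact Or.inr (hcross h hvw hadj)
      · exact Or.inl (hcross h hvw.symm hadj)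
  have hdisj : ∀ v, E v₀ v → ¬ E w₀ v := by
    intro v h1 h2
    have h3 : E v₀ w₀ := htrans h1 (hsymm h2)
    have h4 : ∀ v, E v₀ v := fun v => (hXY v).elim id fun h => htrans h3 h
    have : Nonempty V := ⟨v₀⟩
    exact hlin.false_of_friendship hG.deg hG.three_le fun u v => htrans (hsymm (h4 u)) (h4 v)
  have hnY : ∀ {v}, ¬ E v₀ v → E w₀ v := fun {v} h => (hXY v).resolve_left h
  have hadjX : ∀ {v w}, E v₀ v → G.Adj v w → ¬ E v₀ w := fun h1 h2 h3 =>
    hdisj _ h3 (hcross h1 hvw h2)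
  have hadjY : ∀ {v w}, ¬ E v₀ v → G.Adj v w → E v₀ w := fun h1 h2 =>
    hcross (hnY h1) hvw.symm h2
  let P := {v // E v₀ v}
  let L := {v // ¬ E v₀ v}
  let : Membership P L := ⟨fun l p => G.Adj p.1 l.1⟩
  have hmem : ∀ (p : P) (l : L), p ∈ l ↔ G.Adj p.1 l.1 := fun _ _ => Iff.rfl
  have hpoint : ∀ {l₁ l₂ : L}, l₁ ≠ l₂ → ∃ p : P, p ∈ l₁ ∧ p ∈ l₂ := by
    rintro ⟨l₁, h₁⟩ ⟨l₂, h₂⟩ -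
    obtain ⟨w, hw₁, hw₂⟩ := htrans (hsymm (hnY h₁)) (hnY h₂)
    exact ⟨⟨w, hadjY h₁ hw₁⟩, hw₁.symm, hw₂.symm⟩
  have hline : ∀ {p₁ p₂ : P}, p₁ ≠ p₂ → ∃ l : L, p₁ ∈ l ∧ p₂ ∈ l := by
    rintro ⟨p₁, h₁⟩ ⟨p₂, h₂⟩ -
    obtain ⟨w, hw₁, hw₂⟩ := htrans (hsymm h₁) h₂
    exact ⟨⟨w, hadjX h₁ hw₁⟩, hw₁, hw₂⟩
  let plane : Configuration.ProjectivePlane P L :=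
    { exists_point := by
        rintro ⟨l, hl⟩
        obtain ⟨p, hp, -⟩ := hthird l l l
        obtain ⟨m, hm, hml, -⟩ := hthird p l l
        obtain ⟨p', hp', hpp, -⟩ := hthird m p p
        exact ⟨⟨p', hadjY (hadjX (hadjY hl hp) hm) hp'⟩,
          fun h => hml (hlin hpp hp'.symm hm h hp.symm)⟩
      exists_line := by
        rintro ⟨p, hp⟩
        obtain ⟨l, hl, -⟩ := hthird p p p
        obtain ⟨q, hq, hqp, -⟩ := hthird l p p
        obtain ⟨m, hm, hml, -⟩ := hthird q l l
        exact ⟨⟨m, hadjX (hadjY (hadjX hp hl) hq) hm⟩,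
          fun h => hml (hlin hqp hm h hq.symm hl)⟩
      eq_or_eq := by
        rintro ⟨p₁, _⟩ ⟨p₂, _⟩ ⟨l₁, _⟩ ⟨l₂, _⟩ h1 h2 h3 h4
        by_cases h : p₁ = p₂
        · exact Or.inl (Subtype.ext h)
        · exact Or.inr (Subtype.ext (hlin h h1 h2 h3 h4))
      mkPoint := fun h => (hpoint h).choose
      mkPoint_ax := fun h => (hpoint h).choose_spec
      mkLine := fun h => (hline h).choose
      mkLine_ax := fun h => (hline h).choose_spec
      -- The point `p₂` is `v₀`, on three lines `l₂`, `l₃`, `l₄`; `p₁` lies on `l₄` and `p₃` on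
      -- `l₂`. For `l₁` take a line through a further point `q` of `l₃`, other than `l₃` and the
      -- line joining `q` to `p₃`.
      exists_config := by
        have hp₂ := hrefl v₀
        obtain ⟨l₂, h₂, -⟩ := hthird v₀ v₀ v₀
        obtain ⟨l₃, h₃, h₃₂, -⟩ := hthird v₀ l₂ l₂
        obtain ⟨l₄, h₄, h₄₂, h₄₃⟩ := hthird v₀ l₂ l₃
        obtain ⟨p₁, k₁, k₁', -⟩ := hthird l₄ v₀ v₀
        obtain ⟨p₃, k₃, k₃', -⟩ := hthird l₂ v₀ v₀
        obtain ⟨q, hq, hq', -⟩ := hthird l₃ v₀ v₀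
        have hX₁ := hadjY (hadjX hp₂ h₄) k₁
        have hX₃ := hadjY (hadjX hp₂ h₂) k₃
        have hXq := hadjY (hadjX hp₂ h₃) hq
        have n₃₃ : ¬ G.Adj p₃ l₃ := fun h => h₃₂ (hlin k₃' h h₃ k₃.symm h₂)
        have hqp : q ≠ p₃ := by rintro rfl; exact n₃₃ hq.symm
        obtain ⟨m, hqm, hpm⟩ := htrans (hsymm hXq) hX₃
        obtain ⟨l₁, h₁, h₁₃, h₁m⟩ := hthird q l₃ m
        refine ⟨⟨p₁, hX₁⟩, ⟨v₀, hp₂⟩, ⟨p₃, hX₃⟩, ⟨l₁, hadjX hXq h₁⟩, ⟨l₂, hadjX hp₂ h₂⟩,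
          ⟨l₃, hadjX hp₂ h₃⟩, ?_, ?_, ?_, h₂, h₃, ?_, k₃.symm, n₃₃⟩
        · exact fun h => h₄₂ (hlin k₁' k₁.symm h₄ h h₂)
        · exact fun h => h₄₃ (hlin k₁' k₁.symm h₄ h h₃)
        · exact fun h => h₁₃ (hlin hq' h₁ h hq.symm h₃)
        · exact fun h => h₁m (hlin hqp h₁ h hqm hpm) }
  refine ⟨P, L, inferInstance, inferInstance, inferInstance, plane, ?_, ⟨?_⟩⟩
  · have h1 := Configuration.ProjectivePlane.lineCount_eq (P := P) L ⟨v₀, hrefl v₀⟩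
    have h2 : Configuration.lineCount L (⟨v₀, hrefl v₀⟩ : P) = d := by
      rw [← hG.deg v₀, ← SimpleGraph.card_neighborSet_eq_degree, ← Nat.card_eq_fintype_card,
        Configuration.lineCount]
      refine Nat.card_congr ⟨fun l => ⟨l.1.1, l.2⟩, fun l => ⟨⟨l.1, hadjX (hrefl v₀) l.2⟩, l.2⟩,
        fun _ => rfl, fun _ => rfl⟩
    omega
  · classical
    refine RelIso.symm ⟨Equiv.sumCompl (E v₀), ?_⟩
    rintro (⟨a, ha⟩ | ⟨a, ha⟩) (⟨b, hb⟩ | ⟨b, hb⟩)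
    · exact ⟨fun h => hadjX ha h hb, fun h => h.elim⟩
    · exact Iff.rfl
    · exact ⟨fun h => G.adj_symm h, fun h => G.adj_symm h⟩
    · exact ⟨fun h => hb (hadjY ha h), fun h => h.elim⟩

end Plane

/-! ### The gap of incidence graphs of planes. -/

section PlaneConverse

variable {V : Type*} [Fintype V] [DecidableEq V] {G : SimpleGraph V} [DecidableRel G.Adj] {d : ℕ}

/-- The square of the adjacency matrix is `d - 1` plus an all-ones block on each of the two classes;
the blocks contribute squares of class sums. -/
lemma expansion_of_classes (c : V → Prop) [DecidablePred c]
    (h : ∀ u v, (#(G.neighborFinset u ∩ G.neighborFinset v) : ℝ) =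
      if u = v then (d : ℝ) else if (c u ↔ c v) then 1 else 0) (f : V → ℝ) :
    ((d : ℝ) - 1) * ∑ v, f v ^ 2 ≤ ∑ w, (∑ v ∈ G.neighborFinset w, f v) ^ 2 := by
  have h1 : ∑ w, (∑ v ∈ G.neighborFinset w, f v) ^ 2 = ((d : ℝ) - 1) * ∑ v, f v ^ 2 +
      ((∑ v, if c v then f v else 0) ^ 2 + (∑ v, if c v then 0 else f v) ^ 2) := by
    rw [sum_sq_sum_neighborFinset, sq (∑ v, if c v then f v else 0),
      sq (∑ v, if c v then 0 else f v), sum_mul_sum, sum_mul_sum, mul_sum, ← sum_add_distrib,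
      ← sum_add_distrib]
    refine sum_congr rfl fun u _ => ?_
    have h2 : ((d : ℝ) - 1) * f u ^ 2 = ∑ v, if u = v then ((d : ℝ) - 1) * f u ^ 2 else 0 := by
      simp
    rw [h2, ← sum_add_distrib, ← sum_add_distrib]
    refine sum_congr rfl fun v _ => ?_
    rw [h]
    by_cases huv : u = v
    · subst huv
      by_cases hu : c u <;> simp [hu] <;> ring
    · by_cases hu : c u <;> by_cases hv : c v <;> simp [huv, hu, hv]
  rw [h1]
  have := sq_nonneg (∑ v, if c v then f v else 0)
  have := sq_nonneg (∑ v, if c v then 0 else f v)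
  linarith

open Configuration

lemma natCard_neighborSet_incidenceGraph {P L : Type u} [Finite P] [Finite L] [Membership P L]
    [ProjectivePlane P L] (x : P ⊕ L) :
    Nat.card ((incidenceGraph P L).neighborSet x) = ProjectivePlane.order P L + 1 := by
  rcases x with p | l
  · rw [← ProjectivePlane.lineCount_eq L p, lineCount]
    symm
    refine Nat.card_eq_of_bijective
      (fun l : {l : L // p ∈ l} => (⟨Sum.inr l.1, l.2⟩ : (incidenceGraph P L).neighborSet (Sum.inl p)))
      ⟨fun a b hab => ?_, ?_⟩
    · simpa [Subtype.ext_iff] using hab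
    · rintro ⟨q | l, h⟩
      · exact h.elim
      · exact ⟨⟨l, h⟩, rfl⟩
  · rw [← ProjectivePlane.pointCount_eq P l, pointCount]
    symm
    refine Nat.card_eq_of_bijective
      (fun p : {p : P // p ∈ l} => (⟨Sum.inl p.1, p.2⟩ : (incidenceGraph P L).neighborSet (Sum.inr l)))
      ⟨fun a b hab => ?_, ?_⟩
    · simpa [Subtype.ext_iff] using hab
    · rintro ⟨q | l, h⟩
      · exact ⟨⟨q, h⟩, rfl⟩
      · exact h.elim

lemma incidenceGraph_connected {P L : Type u} [Membership P L] [ProjectivePlane P L] :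
    (incidenceGraph P L).Connected := by
  have hPL : ∀ {p : P} {l : L}, p ∈ l → (incidenceGraph P L).Adj (Sum.inl p) (Sum.inr l) :=
    fun h => h
  obtain ⟨p₀, -⟩ := ProjectivePlane.exists_config (P := P) (L := L)
  have hp : ∀ p : P, (incidenceGraph P L).Reachable (Sum.inl p₀) (Sum.inl p) := by
    intro p
    rcases eq_or_ne p₀ p with rfl | h
    · rfl
    · have h1 := HasLines.mkLine_ax (L := L) h
      exact (hPL h1.1).reachable.trans (hPL h1.2).symm.reachable
  have hpoint : ∀ l : L, ∃ p : P, p ∈ l := by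
    intro l
    obtain ⟨q, hq⟩ := Nondegenerate.exists_point (P := P) l
    obtain ⟨m, hm⟩ := Nondegenerate.exists_line (L := L) q
    -- Every line other than `l` meets `l`; if the chosen `m` is `l` itself, the line `l₂` of the
    -- configuration serves, since it carries `p₂` in case it equals `l`.
    by_cases h : l = m
    · obtain ⟨p₁, p₂, p₃, l₁, l₂, l₃, h1, h2, h3, h4, h5, h6, h7, h8⟩ :=
        ProjectivePlane.exists_config (P := P) (L := L)
      rcases eq_or_ne l l₂ with rfl | hne
      · exact ⟨p₂, h4⟩
      · exact ⟨_, (HasPoints.mkPoint_ax (P := P) hne).1⟩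
    · exact ⟨_, (HasPoints.mkPoint_ax (P := P) h).1⟩
  have hall : ∀ x, (incidenceGraph P L).Reachable (Sum.inl p₀) x := by
    rintro (p | l)
    · exact hp p
    · obtain ⟨p, h⟩ := hpoint l
      exact (hp p).trans (hPL h).reachable
  have : Nonempty (P ⊕ L) := ⟨Sum.inl p₀⟩
  exact ⟨fun x y => (hall x).symm.trans (hall y)⟩

lemma card_inter_neighborFinset_of_iso {V P L : Type u} [Fintype V] [DecidableEq V]
    {G : SimpleGraph V} [DecidableRel G.Adj] [Finite P] [Finite L] [Membership P L]
    [ProjectivePlane P L] (φ : G ≃g incidenceGraph P L) (u v : V) :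
    (#(G.neighborFinset u ∩ G.neighborFinset v) : ℝ) =
      if u = v then ((ProjectivePlane.order P L + 1 : ℕ) : ℝ) else
        if ((φ u).isLeft = true ↔ (φ v).isLeft = true) then 1 else 0 := by
  have hadj : ∀ x y, G.Adj x y ↔ (incidenceGraph P L).Adj (φ x) (φ y) :=
    fun x y => (SimpleGraph.Iso.map_adj_iff φ).symm
  split_ifs with h1 h2
  · subst h1
    rw [inter_self, ← natCard_neighborSet_incidenceGraph (φ u),
      ← Nat.card_congr (φ.mapNeighborSet u), Nat.card_eq_fintype_card,
      SimpleGraph.card_neighborSet_eq_degree, SimpleGraph.card_neighborFinset_eq_degree]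
  · have h3 : φ u ≠ φ v := fun h => h1 (φ.injective h)
    have h4 : ∃! y, (incidenceGraph P L).Adj (φ u) y ∧ (incidenceGraph P L).Adj (φ v) y := by
      generalize φ u = a at h2 h3
      generalize φ v = b at h2 h3
      rcases a with a | a <;> rcases b with b | b
      · have hab : a ≠ b := fun h => h3 (by rw [h])
        have h5 := HasLines.mkLine_ax (L := L) hab
        refine ⟨Sum.inr (HasLines.mkLine hab), h5, ?_⟩
        rintro (y | y) ⟨hy1, hy2⟩
        · exact hy1.elim
        · exact congrArg Sum.inr ((Nondegenerate.eq_or_eq hy1 hy2 h5.1 h5.2).resolve_left hab)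
      · simp at h2
      · simp at h2
      · have hab : a ≠ b := fun h => h3 (by rw [h])
        have h5 := HasPoints.mkPoint_ax (P := P) hab
        refine ⟨Sum.inl (HasPoints.mkPoint hab), h5, ?_⟩
        rintro (y | y) ⟨hy1, hy2⟩
        · exact congrArg Sum.inl ((Nondegenerate.eq_or_eq hy1 h5.1 hy2 h5.2).resolve_right hab)
        · exact hy1.elim
    obtain ⟨y, hy, hy'⟩ := h4
    have h5 : G.neighborFinset u ∩ G.neighborFinset v = {φ.symm y} := by
      ext x
      simp only [mem_inter, SimpleGraph.mem_neighborFinset, mem_singleton, hadj]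
      constructor
      · intro h
        rw [← hy' _ h]
        simp
      · rintro rfl
        simpa using hy
    rw [h5, card_singleton, Nat.cast_one]
  · rw [Nat.cast_eq_zero, card_eq_zero, eq_empty_iff_forall_notMem]
    intro x hx
    simp only [mem_inter, SimpleGraph.mem_neighborFinset, hadj] at hx
    obtain ⟨hx1, hx2⟩ := hx
    generalize φ u = a at *
    generalize φ v = b at *
    generalize φ x = c at *
    rcases a with a | a <;> rcases b with b | b <;> rcases c with c | c <;>
      first | exact hx1.elim | exact hx2.elim | simp at h2

end PlaneConverse

/-! ### Translation into statements about the gap. -/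

namespace FiniteGraph

variable {d : ℕ} {G : FiniteGraph.{u}}

lemma sq_sqrt_div {x : ℝ} (hx : 0 ≤ x) (y : ℝ) : (√x / y) ^ 2 = x / y ^ 2 := by
  rw [div_pow, Real.sq_sqrt hx]

open scoped Classical in
lemma gap_sq_mul_le (hd : 3 ≤ d) (hG : G ∈ minDegreeGE d) (f : G.V → ℝ) :
    G.gap ^ 2 * ∑ v, (G.graph.degree v : ℝ) * f v ^ 2 ≤
      ∑ w, (1 / (G.graph.degree w : ℝ)) * (∑ v ∈ G.graph.neighborFinset w, f v) ^ 2 := by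
  have hleast := isLeast_gap (by omega) hG
  refine sq_mul_le_of_spectrum G.graph (fun v => ?_) (fun μ hμ => hleast.2 ⟨μ, hμ, rfl⟩) ?_ f
  · have := hG.2.2 v
    omega
  · obtain ⟨μ, -, h⟩ := hleast.1
    rw [← h]
    exact abs_nonneg _

lemma gap_le (hd : 3 ≤ d) (hG : G ∈ minDegreeGE d) : G.gap ≤ √((d : ℝ) - 1) / d := by
  classical
  have hd3 : (3 : ℝ) ≤ d := by exact_mod_cast hd
  have := hG.1.nonempty
  have h1 := (le_of_minDegree G.graph hd hG.2.2 (gap_sq_mul_le hd hG)).1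
  rw [← sq_sqrt_div (by linarith)] at h1
  exact le_of_sq_le_sq h1 (by positivity)

lemma mem_regular_of_gap_eq (hd : 3 ≤ d) (hG : G ∈ minDegreeGE d)
    (h : G.gap = √((d : ℝ) - 1) / d) : G ∈ regular d := by
  classical
  have hd3 : (3 : ℝ) ≤ d := by exact_mod_cast hd
  have := hG.1.nonempty
  have h1 := (le_of_minDegree G.graph hd hG.2.2 (gap_sq_mul_le hd hG)).2
  rw [h, sq_sqrt_div (by linarith)] at h1
  exact ⟨hG.1, hG.2.1, h1 rfl⟩

/-- In the regular case the degree factors cancel, and the quadratic form inequality becomes `A² > d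
- 2`. -/
lemma mem_planeIncidenceGraphs_of_lt_gap (hd : 3 ≤ d) (hG : G ∈ regular d)
    (h : √((d : ℝ) - 2) / d < G.gap) : G ∈ planeIncidenceGraphs.{u} (d - 1) := by
  classical
  have hd3 : (3 : ℝ) ≤ d := by exact_mod_cast hd
  have hd0 : (0 : ℝ) < d := by linarith
  have hmin := regular_subset_minDegreeGE d hG
  have hexp : ∀ f : G.V → ℝ, f ≠ 0 → ((d : ℝ) - 2) * ∑ v, f v ^ 2 <
      ∑ w, (∑ v ∈ G.graph.neighborFinset w, f v) ^ 2 := by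
    intro f hf
    have h1 := gap_sq_mul_le hd hmin f
    have hsum : ∑ v, (G.graph.degree v : ℝ) * f v ^ 2 = d * ∑ v, f v ^ 2 := by
      rw [mul_sum]
      exact sum_congr rfl fun v _ => by rw [hG.2.2 v]
    have hsum' : ∑ w, (1 / (G.graph.degree w : ℝ)) *
        (∑ v ∈ G.graph.neighborFinset w, f v) ^ 2 =
        1 / d * ∑ w, (∑ v ∈ G.graph.neighborFinset w, f v) ^ 2 := by
      rw [mul_sum]
      exact sum_congr rfl fun w _ => by rw [hG.2.2 w]
    rw [hsum, hsum'] at h1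
    have h2 : ((d : ℝ) - 2) / d ^ 2 < G.gap ^ 2 := by
      rw [← sq_sqrt_div (by linarith)]
      exact pow_lt_pow_left₀ h (by positivity) two_ne_zero
    have h3 : (d : ℝ) - 2 < G.gap ^ 2 * d ^ 2 := by rwa [div_lt_iff₀ (by positivity)] at h2
    have h4 : 0 < ∑ v, f v ^ 2 := by
      obtain ⟨v, hv⟩ := Function.ne_iff.1 hf
      have hv' : f v ≠ 0 := hv
      exact sum_pos' (fun _ _ => sq_nonneg _) ⟨v, mem_univ _, by positivity⟩
    calc ((d : ℝ) - 2) * ∑ v, f v ^ 2 < G.gap ^ 2 * d ^ 2 * ∑ v, f v ^ 2 :=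
          mul_lt_mul_of_pos_right h3 h4
      _ = d * (G.gap ^ 2 * (d * ∑ v, f v ^ 2)) := by ring
      _ ≤ d * (1 / d * ∑ w, (∑ v ∈ G.graph.neighborFinset w, f v) ^ 2) :=
          mul_le_mul_of_nonneg_left h1 hd0.le
      _ = _ := by rw [← mul_assoc, mul_one_div_cancel hd0.ne', one_mul]
  exact (isTightSpace_of_expansion hd hG.2.2 hexp).exists_projectivePlane hG.1

lemma mem_regular_of_mem_planeIncidenceGraphs (hd : 3 ≤ d)
    (hG : G ∈ planeIncidenceGraphs.{u} (d - 1)) : G ∈ regular d := by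
  classical
  obtain ⟨P, L, _, _, _, _, horder, ⟨φ⟩⟩ := hG
  have hdeg : ∀ v, G.graph.degree v = d := by
    intro v
    rw [← SimpleGraph.card_neighborSet_eq_degree, ← Nat.card_eq_fintype_card,
      Nat.card_congr (φ.mapNeighborSet v), natCard_neighborSet_incidenceGraph, horder]
    omega
  have hconn : G.graph.Connected := φ.connected_iff.2 incidenceGraph_connected
  refine ⟨hconn, ?_, hdeg⟩
  obtain ⟨v⟩ := hconn.nonempty
  have := G.graph.degree_lt_card_verts v
  rw [hdeg] at this
  omega

/-- An eigenvector of the Laplacian for `μ` is one of the adjacency matrix for `d(1 - μ)`, so the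
expansion inequality gives `d - 1 ≤ d²(1 - μ)²`. -/
lemma le_gap_of_mem_planeIncidenceGraphs (hd : 3 ≤ d)
    (hG : G ∈ planeIncidenceGraphs.{u} (d - 1)) : √((d : ℝ) - 1) / d ≤ G.gap := by
  classical
  have hreg := mem_regular_of_mem_planeIncidenceGraphs hd hG
  have hdeg := hreg.2.2
  have hd3 : (3 : ℝ) ≤ d := by exact_mod_cast hd
  have hd0 : (0 : ℝ) < d := by linarith
  obtain ⟨P, L, _, _, _, _, horder, ⟨φ⟩⟩ := hG
  have hexp := expansion_of_classes (d := d) (G := G.graph) (fun v => (φ v).isLeft = true)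
    (fun u v => by
      rw [card_inter_neighborFinset_of_iso φ, horder, Nat.sub_add_cancel (by omega)])
  obtain ⟨μ, hμ, h⟩ := (isLeast_gap (by omega) (regular_subset_minDegreeGE d hreg)).1
  rw [← h]
  rw [laplacianSpectrum, ← Module.End.hasEigenvalue_iff_mem_spectrum] at hμ
  obtain ⟨f, hf⟩ := hμ.exists_hasEigenvector
  have h1 : ∀ v, ∑ w ∈ G.graph.neighborFinset v, f w = d * (1 - μ) * f v := by
    intro v
    have h2 := congrFun hf.apply_eq_smul v
    rw [normalizedLaplacian_apply_eq, hdeg v, Pi.smul_apply, smul_eq_mul] at h2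
    have h3 : (d : ℝ) * (1 / d * ∑ w ∈ G.graph.neighborFinset v, f w) =
        ∑ w ∈ G.graph.neighborFinset v, f w := by
      rw [← mul_assoc, mul_one_div_cancel hd0.ne', one_mul]
    rw [← h3]
    linear_combination -(d : ℝ) * h2
  have h4 := hexp f
  simp only [h1, mul_pow, ← mul_sum] at h4
  have h5 : 0 < ∑ v, f v ^ 2 := by
    obtain ⟨v, hv⟩ := Function.ne_iff.1 hf.2
    have hv' : f v ≠ 0 := hv
    exact sum_pos' (fun _ _ => sq_nonneg _) ⟨v, mem_univ _, by positivity⟩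
  have h6 := le_of_mul_le_mul_right h4 h5
  have h7 : (√((d : ℝ) - 1) / d) ^ 2 ≤ |μ - 1| ^ 2 := by
    rw [sq_sqrt_div (by linarith), sq_abs, div_le_iff₀ (by positivity)]
    linarith
  exact le_of_sq_le_sq h7 (abs_nonneg _)

end FiniteGraph

open FiniteGraph in
theorem theorem4 (d : ℕ) (hd : 3 ≤ d) :
    (ExistsProjectivePlane.{u} (d - 1) →
      familyGap (regular.{u} d) = √((d : ℝ) - 1) / d ∧
      familyGap (minDegreeGE.{u} d) = √((d : ℝ) - 1) / d ∧
      extremal (minDegreeGE.{u} d) = planeIncidenceGraphs.{u} (d - 1) ∧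
      extremal (regular.{u} d) = planeIncidenceGraphs.{u} (d - 1)) ∧
    (∀ G ∈ regular.{u} d, G ∉ planeIncidenceGraphs.{u} (d - 1) →
      G.gap ≤ √((d : ℝ) - 2) / d) ∧
    (¬ ExistsProjectivePlane.{u} (d - 1) →
      (∀ G ∈ minDegreeGE.{u} d, G.gap < √((d : ℝ) - 1) / d) ∧
      familyGap (regular.{u} d) ≤ √((d : ℝ) - 2) / d) := by
  have hd3 : (3 : ℝ) ≤ d := by exact_mod_cast hd
  have hlt : √((d : ℝ) - 2) / d < √((d : ℝ) - 1) / d :=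
    div_lt_div_of_pos_right (Real.sqrt_lt_sqrt (by linarith) (by linarith)) (by linarith)
  have hsecond : ∀ G ∈ regular.{u} d, G ∉ planeIncidenceGraphs.{u} (d - 1) →
      G.gap ≤ √((d : ℝ) - 2) / d := by
    intro G hG hG'
    by_contra! h
    exact hG' (mem_planeIncidenceGraphs_of_lt_gap hd hG h)
  -- Equality in the degree bound forces regularity, and the extremal value exceeds the rigidity
  -- threshold `√(d-2)/d`.
  have hplane : ∀ G ∈ minDegreeGE.{u} d, G.gap = √((d : ℝ) - 1) / d →
      G ∈ planeIncidenceGraphs.{u} (d - 1) := fun G hG h =>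
    mem_planeIncidenceGraphs_of_lt_gap hd (mem_regular_of_gap_eq hd hG h) (h ▸ hlt)
  have hgap : ∀ G ∈ planeIncidenceGraphs.{u} (d - 1), G.gap = √((d : ℝ) - 1) / d := fun G hG =>
    le_antisymm (gap_le hd (regular_subset_minDegreeGE d
      (mem_regular_of_mem_planeIncidenceGraphs hd hG))) (le_gap_of_mem_planeIncidenceGraphs hd hG)
  refine ⟨?_, hsecond, fun hno => ⟨?_, ?_⟩⟩
  · rintro ⟨P, L, hP, hL, hmem, hplanePL, horder⟩
    have : Fintype (P ⊕ L) := Fintype.ofFinite _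
    let G₀ : FiniteGraph.{u} := ⟨P ⊕ L, this, incidenceGraph P L⟩
    have hG₀ : G₀ ∈ planeIncidenceGraphs.{u} (d - 1) :=
      ⟨P, L, hP, hL, hmem, hplanePL, horder, ⟨RelIso.refl _⟩⟩
    have hG₀' := mem_regular_of_mem_planeIncidenceGraphs hd hG₀
    have hfam : ∀ F : Set FiniteGraph.{u}, F ⊆ minDegreeGE d → G₀ ∈ F →
        familyGap F = √((d : ℝ) - 1) / d := by
      intro F hF hG
      refine (isLUB_familyGap (by omega) hF ⟨_, hG⟩).unique ⟨?_, fun b hb => ?_⟩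
      · rintro _ ⟨G, hG, rfl⟩
        exact gap_le hd (hF hG)
      · rw [← hgap G₀ hG₀]
        exact hb ⟨G₀, hG, rfl⟩
    have hext : ∀ F : Set FiniteGraph.{u}, F ⊆ minDegreeGE d → regular d ⊆ F →
        extremal F = planeIncidenceGraphs.{u} (d - 1) := by
      intro F hF hF'
      ext G
      rw [extremal, Set.mem_ofPred_eq, hfam F hF (hF' hG₀')]
      exact ⟨fun h => hplane G (hF h.1) h.2,
        fun h => ⟨hF' (mem_regular_of_mem_planeIncidenceGraphs hd h), hgap G h⟩⟩
    exact ⟨hfam _ (regular_subset_minDegreeGE d) hG₀',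
      hfam _ subset_rfl (regular_subset_minDegreeGE d hG₀'),
      hext _ subset_rfl (regular_subset_minDegreeGE d), hext _ (regular_subset_minDegreeGE d)
        subset_rfl⟩
  · intro G hG
    refine lt_of_le_of_ne (gap_le hd hG) fun h => hno ?_
    obtain ⟨P, L, hP, hL, hmem, hPL, horder, -⟩ := hplane G hG h
    exact ⟨P, L, hP, hL, hmem, hPL, horder⟩
  · refine csSup_le ((regular_nonempty (by omega)).image _) ?_
    rintro _ ⟨G, hG, rfl⟩
    refine hsecond G hG fun h => hno ?_
    obtain ⟨P, L, hP, hL, hmem, hPL, horder, -⟩ := h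
    exact ⟨P, L, hP, hL, hmem, hPL, horder⟩
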